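/- **Theorem.** A compact (Hausdorff) space is *weakly Radon–Nikodým* (WRN) if it is homeomorphic to a weak* compact subset of $X^*$ for some real Banach space $X$ that contains no isomorphic copy of $\ell_1$. A sequence of pairs of disjoint sets $(A_n^0,A_n^1)_{n\in\mathbb N}$ is *independent* if $A_1^{\varepsilon_1}\cap\dots\cap A_m^{\varepsilon_m}\neq\emptyset$ for every $m$ and all $\varepsilon_1,\dots,\varepsilon_m\in\{0,1\}$. For a compact space $M$, a sequence of functions $g_n\colon S\to M$ is *$M$-independent* if there are disjoint closed sets $C,C'\subseteq M$ such that $(g_n^{-1}(C),g_n^{-1}(C'))_{n}$ is independent. A sequence of functions $f_n\colon L\setminus\{r_n\}\to M$ is *$M$-independent* if there are extensions $g_n\colon L\to M$ of $f_n$ (not necessarily continuous) such that $(g_n)_n$ is $M$-independent. (1) Let $L$ be a compact Hausdorff space, $M$ a compact metric space, $(r_\xi)_{\xi\in I}$ a family of distinct points of $L$ (with an arbitrary index set $I$) and $f_\xi\colon L\setminus\{r_\xi\}\to M$ a continuous function for each $\xi\in I$. Let $K\subseteq L\times M^{I}$ be the *split of $L$ induced by* $\{f_\xi:\xi\in I\}$,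 i.e. the subspace consisting of - all points $(r_\xi,y)$ with $\xi\in I$, $y_\xi\in M$ arbitrary and $y_\eta=f_\eta(r_\xi)$ for $\eta\ne\xi$; - all points $(x,y)$ with $x\in L\setminus\{r_\xi:\xi\in I\}$ and $y_\eta=f_\eta(x)$ for every $\eta\in I$. If $L$ is WRN and no sequence $(f_{\xi_n})_{n\in\mathbb N}$ from the family is $M$-independent, then $K$ is WRN. (2) In particular, every Filippov space is WRN. Here a *Filippov space* is the split of $L=[0,1]^2$ induced by the functions $f_\xi\colon L\setminus\{r_\xi\}\to\mathbb S$, $f_\xi(x)=\dfrac{x-r_\xi}{\|x-r_\xi\|}$, where $(r_\xi)_{\xi\in I}$ is any family of distinct points of $[0,1]^2$, $\|\cdot\|$ is the Euclidean norm and $\mathbb S$ is the Euclidean unit circle of $\mathbb R^2$. -/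

import Mathlib

universe u v w

/-- A real normed space `X` contains an isomorphic copy of `ℓ¹`: there is a bounded linear map
`ℓ¹ → X` that is bounded below, i.e. an isomorphism onto its range. -/
def ContainsEllOne (X : Type u) [NormedAddCommGroup X] [NormedSpace ℝ X] : Prop :=
  ∃ (T : lp (fun _ : ℕ => ℝ) 1 →L[ℝ] X) (c : ℝ), 0 < c ∧ ∀ a, c * ‖a‖ ≤ ‖T a‖

/-- `K` is a weakly Radon-Nikodým compact space: it is homeomorphic to a weak* compact subset of
the dual of a real Banach space without isomorphic copies of `ℓ¹`. (Taking `X` in the universe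
of `K` is no restriction: `X` may be replaced by the closed linear span of a choice, for each
pair of points of `K`, of one vector separating them.) -/
def IsWRN (K : Type u) [TopologicalSpace K] : Prop :=
  ∃ (X : Type u) (_ : NormedAddCommGroup X) (_ : NormedSpace ℝ X) (_ : CompleteSpace X),
    ¬ ContainsEllOne X ∧
      ∃ S : Set (WeakDual ℝ X), IsCompact S ∧ Nonempty (K ≃ₜ S)

/-- Independence of a sequence of pairs of sets `(A n false, A n true)`: every finite initial
segment of every choice of one set from each pair has a common point. -/
def IndependentPairs {S : Type u} (A : ℕ → Bool → Set S) : Prop :=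
  ∀ (m : ℕ) (ε : ℕ → Bool), ∃ x, ∀ n < m, x ∈ A n (ε n)

/-- A sequence of functions `g n : S → M` is `M`-independent: for some disjoint closed sets
`C, C'` of `M` the pairs `(g n ⁻¹' C, g n ⁻¹' C')` are independent. -/
def MIndependent {S : Type u} {M : Type v} [TopologicalSpace M] (g : ℕ → S → M) : Prop :=
  ∃ C C' : Set M, IsClosed C ∧ IsClosed C' ∧ Disjoint C C' ∧
    IndependentPairs fun n b => g n ⁻¹' (if b then C' else C)

/-- A sequence of functions `f n`, each defined on `L` minus one point `r n`, is `M`-independent: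
it has extensions to `L` (continuous or not) which form an `M`-independent sequence. -/
def MIndependentPartial {L : Type u} {M : Type v} [TopologicalSpace M] (r : ℕ → L)
    (f : ∀ n, {x : L // x ≠ r n} → M) : Prop :=
  ∃ g : ℕ → L → M, (∀ n (x : {x : L // x ≠ r n}), g n x = f n x) ∧ MIndependent g

/-- The split of `L` induced by the functions `f ξ : L ∖ {r ξ} → M`, as a subset of `L × M ^ ι`.
It consists of
* the points over `r ξ`, whose `ξ`-th coordinate is arbitrary and whose other coordinates are
  `f η (r ξ)`, and
* the points over those `x` outside the family `r`, whose coordinates are all `f η x`. -/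
def splitSpace {L : Type u} {M : Type v} {ι : Type w} (r : ι → L)
    (f : ∀ ξ, {x : L // x ≠ r ξ} → M) : Set (L × (ι → M)) :=
  {p | (∃ ξ, p.1 = r ξ ∧ ∀ η, η ≠ ξ → ∃ h : r ξ ≠ r η, p.2 η = f η ⟨r ξ, h⟩) ∨
    (p.1 ∉ Set.range r ∧ ∀ η, ∃ h : p.1 ≠ r η, p.2 η = f η ⟨p.1, h⟩)}

/-- The unit square `[0,1]²` in the Euclidean plane. -/
abbrev UnitSquare : Type :=
  {x : EuclideanSpace ℝ (Fin 2) // ∀ i, x i ∈ Set.Icc (0 : ℝ) 1}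

/-- The map `x ↦ (x - r) / ‖x - r‖` from the unit square minus the point `r` to the unit circle. -/
noncomputable def directionFrom (r : UnitSquare) (x : {x : UnitSquare // x ≠ r}) :
    Metric.sphere (0 : EuclideanSpace ℝ (Fin 2)) 1 :=
  ⟨‖x.1.1 - r.1‖⁻¹ • (x.1.1 - r.1), by
    have h : ‖x.1.1 - r.1‖ ≠ 0 :=
      norm_ne_zero_iff.mpr (sub_ne_zero.mpr fun h => x.2 (Subtype.ext h))
    rw [mem_sphere_zero_iff_norm, norm_smul, norm_inv, norm_norm, inv_mul_cancel₀ h]⟩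

/-- The Filippov space of a family of points of the unit square. -/
abbrev FilippovSpace {ι : Type w} (r : ι → UnitSquare) : Type w :=
  splitSpace r fun ξ => directionFrom (r ξ)

/-!
The theorem rests on an intrinsic criterion, in both directions. Call a family of continuous real
functions on `K` *tame* if it contains no sequence `f n` for which the pairs of level sets
`{f n ≤ p}`, `{q ≤ f n}` are independent, for some fixed `p < q`. A compact space is weakly
Radon–Nikodým if and only if it carries a bounded tame family separating its points.

* If `K` lies in the dual of `X`, the unit ball of `X` restricted to `K` is such a family:
  functions with independent level sets dominate the unit vectors of `ℓ¹`
  (`IsWRN.exists_isTame`).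
* Conversely (`IsTame.isWRN`), a bounded tame family `F` is totally bounded in `L¹(ν)` for every
  finite measure `ν` on `K`. If it were not, take a weak limit `g` in `L²(ν)`, along an
  ultrafilter, of an `L¹`-separated sequence `f n`, together with a weak limit of `|f n - g|`.
  On a set where the second limit is large compared with the variation of `g`, the functions
  oscillate on all subsets of positive measure, so independent level sets can be picked inductively
  (`exists_oscillation_set`, `exists_independentPairs_of_splitting`). Total boundedness passes to
  the absolutely convex hull of `F`. On the other hand an `ℓ¹`-sequence in `C(K)` is separated in
  `L¹(ν)` for some `ν`, by a Hahn–Banach argument (`EllOneBelow.exists_measure_separated`).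
  The predual is obtained by interpolating between the `ℓ¹`-norm on the span of `F` and the norm
  of `C(K)`, as in the factorization of Davis, Figiel, Johnson and Pełczyński. Its unit ball is
  close to multiples of the hull of `F`, hence contains no `ℓ¹`-sequence of `C(K)`; a gliding hump
  shows that the interpolation space does not contain `ℓ¹` (`not_ellOneBelow_interpSeminorm`).

For the split `K` of `L`, the family consists of a tame separating family of `L`, pulled back to
`K`, and of the functions `dist d (y ξ)`, with `d ∈ M`. Independence of a sequence of the latter
gives `M`-independence of the corresponding `f ξ`, since each fibre of `K → L` moves one coordinate
only (`mIndependentPartial_of_splitSpace`).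

For a Filippov space, every sequence of direction functions has a subsequence that converges
pointwise, while an independent sequence admits a point where the values alternate between two
disjoint closed sets (`not_mIndependentPartial_directionFrom`).
-/

open MeasureTheory Filter Topology
open scoped NNReal

/-! ### Weak limits and oscillation in `L²` -/

/-- Bounded families in a Hilbert space have weak limits along every ultrafilter. -/
theorem exists_weak_limit_ultrafilter {H : Type*} [NormedAddCommGroup H] [InnerProductSpace ℝ H]
    [CompleteSpace H] {α : Type*} (U : Ultrafilter α) {G : α → H} {R : ℝ} (hG : ∀ n, ‖G n‖ ≤ R) :
    ∃ g : H, ∀ u : H, Tendsto (fun n => inner ℝ (G n) u) U (𝓝 (inner ℝ g u)) := by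
  let a : α → WeakDual ℝ H := fun n =>
    StrongDual.toWeakDual (InnerProductSpace.toDual ℝ H (G n))
  have hK := WeakDual.isCompact_closedBall (𝕜 := ℝ) (E := H) 0 R
  obtain ⟨φ, -, hφ⟩ := hK.ultrafilter_le_nhds (U.map a) (by
    rw [le_principal_iff]
    refine Filter.mem_map.2 (Filter.univ_mem' fun n => ?_)
    simpa [a] using hG n)
  refine ⟨(InnerProductSpace.toDual ℝ H).symm (WeakDual.toStrongDual φ), fun u => ?_⟩
  have h1 : Tendsto a U (𝓝 φ) := hφ
  have h2 := ((WeakDual.eval_continuous (𝕜 := ℝ) u).tendsto φ).comp h1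
  rw [InnerProductSpace.toDual_symm_apply]
  exact h2

/-- Weak limits in `L²` of a finite measure, expressed through integrals over measurable sets. -/
theorem exists_setIntegral_limit_ultrafilter {Ω : Type*} [MeasurableSpace Ω] (ν : Measure Ω)
    [IsFiniteMeasure ν] {α : Type*} (U : Ultrafilter α) {G : α → Lp ℝ 2 ν} {R : ℝ}
    (hG : ∀ n, ‖G n‖ ≤ R) :
    ∃ g : Lp ℝ 2 ν, ∀ B, MeasurableSet B →
      Tendsto (fun n => ∫ x in B, G n x ∂ν) U (𝓝 (∫ x in B, g x ∂ν)) := by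
  obtain ⟨g, hg⟩ := exists_weak_limit_ultrafilter U hG
  refine ⟨g, fun B hB => ?_⟩
  have := hg (indicatorConstLp 2 hB (measure_ne_top ν B) 1)
  simp_rw [real_inner_comm _ (G _), real_inner_comm _ g, L2.inner_indicatorConstLp_one] at this
  exact this

/-- A sequence of functions that is bounded in `L²` and separated in `L¹` oscillates: on some set
of positive measure, and for some `c` and `η > 0`, the functions take values above `c + η` and below
`c - η` on every subset of positive measure, for most indices in the sense of a fixed nonprincipal
ultrafilter. The set is found where the weak limit of `|G n - g|` is large compared with the
variation of the weak limit `g`. -/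
theorem exists_oscillation_set {Ω : Type*} [MeasurableSpace Ω] (ν : Measure Ω)
    [IsFiniteMeasure ν] {G : ℕ → Lp ℝ 2 ν} {R δ : ℝ} (hG : ∀ n, ‖G n‖ ≤ R) (hδ : 0 < δ)
    (hsep : ∀ n m, n ≠ m → δ ≤ ∫ x, |G n x - G m x| ∂ν) :
    ∃ (A : Set Ω) (c η : ℝ), MeasurableSet A ∧ 0 < η ∧ 0 < ν A ∧
      ∀ B ⊆ A, MeasurableSet B → 0 < ν B → ∀ᶠ n in (hyperfilter ℕ : Filter ℕ),
        0 < ν (B ∩ {x | c + η ≤ G n x}) ∧ 0 < ν (B ∩ {x | G n x ≤ c - η}) := by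
  set U := hyperfilter ℕ
  have hint : ∀ F : Lp ℝ 2 ν, Integrable F ν := fun F => (Lp.memLp F).integrable (by norm_num)
  obtain ⟨g, hg⟩ := exists_setIntegral_limit_ultrafilter ν U hG
  obtain ⟨h, hh⟩ := exists_setIntegral_limit_ultrafilter ν U (G := fun n => |G n - g|)
    (R := R + ‖g‖) (fun n => by
      rw [norm_abs_eq_norm]; exact (norm_sub_le _ _).trans (by gcongr; exact hG n))
  have habs : ∀ n, (fun x => |G n x - g x|) =ᵐ[ν] (|G n - g| : Lp ℝ 2 ν) := fun n => by
    filter_upwards [Lp.coeFn_abs (G n - g), Lp.coeFn_sub (G n) g] with x h1 h2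
    rw [h1, h2]; rfl
  have hiabs : ∀ n, Integrable (fun x => |G n x - g x|) ν := fun n =>
    ((hint (G n)).sub (hint g)).abs
  replace hh : ∀ B, MeasurableSet B →
      Tendsto (fun n => ∫ x in B, |G n x - g x| ∂ν) U (𝓝 (∫ x in B, h x ∂ν)) := fun B hB => by
    refine (hh B hB).congr fun n => ?_
    exact integral_congr_ae ((habs n).symm.filter_mono (ae_mono Measure.restrict_le_self))
  -- At most one term is `L¹`-close to `g`.
  have hpos : 0 < ∫ x, h x ∂ν := by
    have h0 := hh Set.univ MeasurableSet.univ
    simp only [Measure.restrict_univ] at h0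
    refine lt_of_lt_of_le (half_pos hδ) (ge_of_tendsto h0 ?_)
    have hfin : {n | ∫ x, |G n x - g x| ∂ν < δ / 2}.Subsingleton := by
      intro n hn m hm
      by_contra hnm
      have h1 := hsep n m hnm
      have h2 : ∫ x, |G n x - G m x| ∂ν ≤
          ∫ x, (|G n x - g x| + |G m x - g x|) ∂ν := by
        refine integral_mono ((hint _).sub (hint _)).abs ((hiabs n).add (hiabs m)) fun x => ?_
        simpa [abs_sub_comm (G m x) (g x)] using abs_sub_le (G n x) (g x) (G m x)
      rw [integral_add (hiabs n) (hiabs m)] at h2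
      simp only [Set.mem_ofPred_eq] at hn hm
      linarith
    have := hfin.finite.compl_mem_hyperfilter
    filter_upwards [this] with n hn
    simpa using hn
  -- Some set `{h > 8 η}` has positive measure.
  obtain ⟨η, hη, hηpos⟩ : ∃ η : ℝ, 0 < η ∧ 0 < ν {x | 8 * η < h x} := by
    by_contra! hcon
    have hle : h ≤ᵐ[ν] (fun _ => (0 : ℝ)) := by
      have : ∀ᵐ x ∂ν, ∀ k : ℕ, h x ≤ 8 * (1 / (k + 1 : ℝ)) := by
        rw [ae_all_iff]
        intro k
        have := hcon (1 / (k + 1 : ℝ)) (by positivity)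
        rw [ae_iff]
        simpa using this
      filter_upwards [this] with x hx
      have ht := (tendsto_one_div_add_atTop_nhds_zero_nat (𝕜 := ℝ)).const_mul 8
      simpa using ge_of_tendsto' ht hx
    have := integral_mono_ae (hint h) (integrable_const (0 : ℝ)) hle
    simp at this
    linarith
  have hhm : Measurable h := (Lp.stronglyMeasurable h).measurable
  have hgm : Measurable g := (Lp.stronglyMeasurable g).measurable
  obtain ⟨c, hc⟩ : ∃ c : ℚ, 0 < ν ({x | 8 * η < h x} ∩ {x | |g x - c| < η}) := by
    by_contra! hcon
    have : ν (⋃ c : ℚ, {x | 8 * η < h x} ∩ {x | |g x - c| < η}) = 0 :=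
      measure_iUnion_null fun c => le_antisymm (hcon c) bot_le
    refine hηpos.ne' (measure_mono_null (fun x hx => ?_) this)
    obtain ⟨c, hc⟩ := exists_rat_near (g x) hη
    exact Set.mem_iUnion.2 ⟨c, hx, hc⟩
  refine ⟨_, c, η, ?_, hη, hc, ?_⟩
  · exact (measurableSet_lt measurable_const hhm).inter
      (measurableSet_lt ((hgm.sub_const _).abs) measurable_const)
  intro B hBA hB hνB
  have hνB' : 0 < ν.real B := by
    rw [measureReal_def]; exact ENNReal.toReal_pos hνB.ne' (measure_ne_top _ _)
  have hlow : 8 * η * ν.real B ≤ ∫ x in B, h x ∂ν := by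
    have : ∫ _ in B, 8 * η ∂ν ≤ ∫ x in B, h x ∂ν :=
      setIntegral_mono_on (integrable_const _).integrableOn (hint h).integrableOn hB
        fun x hx => (hBA hx).1.le
    simpa [mul_comm] using this
  have hdiff : Tendsto (fun n => ∫ x in B, (G n x - g x) ∂ν) U (𝓝 0) := by
    have := (hg B hB).sub_const (∫ x in B, g x ∂ν)
    rw [sub_self] at this
    refine this.congr fun n => ?_
    rw [integral_sub (hint _).integrableOn (hint _).integrableOn]
  -- `|t| = 2 t⁺ - t = 2 t⁻ + t`, so both one-sided deviations carry half of the mass of `h`.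
  have e1 : ∀ᶠ n in (U : Filter ℕ), 7 * η * ν.real B < ∫ x in B, |G n x - g x| ∂ν :=
    (hh B hB).eventually (lt_mem_nhds (lt_of_lt_of_le (by nlinarith) hlow))
  have e2 : ∀ᶠ n in (U : Filter ℕ), ∫ x in B, (G n x - g x) ∂ν < η * ν.real B :=
    hdiff.eventually (gt_mem_nhds (by positivity))
  have e3 : ∀ᶠ n in (U : Filter ℕ), -(η * ν.real B) < ∫ x in B, (G n x - g x) ∂ν :=
    hdiff.eventually (lt_mem_nhds (by rw [neg_lt_zero]; positivity))
  filter_upwards [e1, e2, e3] with n h1 h2 h3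
  have hiB : IntegrableOn (fun x => |G n x - g x|) B ν := (hiabs n).integrableOn
  have hiB' : IntegrableOn (fun x => G n x - g x) B ν := ((hint _).sub (hint _)).integrableOn
  constructor
  · rw [pos_iff_ne_zero]
    intro h0
    have hae : ∀ᵐ x ∂(ν.restrict B), |G n x - g x| + (G n x - g x) ≤ 4 * η := by
      rw [ae_restrict_iff' hB]
      have : ∀ᵐ x ∂ν, x ∉ B ∩ {x | c + η ≤ G n x} := measure_eq_zero_iff_ae_notMem.1 h0
      filter_upwards [this] with x hx hxB
      have h4 : ¬ (c + η ≤ G n x) := fun h => hx ⟨hxB, h⟩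
      have h5 : |g x - c| < η := (hBA hxB).2
      rw [abs_lt] at h5
      push Not at h4
      rcases abs_cases (G n x - g x) with ⟨h6, _⟩ | ⟨h6, _⟩ <;> rw [h6] <;> linarith
    have := integral_mono_ae (hiB.add hiB') (integrable_const (4 * η)) hae
    simp only [Pi.add_apply] at this
    rw [integral_add hiB hiB'] at this
    simp at this
    nlinarith
  · rw [pos_iff_ne_zero]
    intro h0
    have hae : ∀ᵐ x ∂(ν.restrict B), |G n x - g x| - (G n x - g x) ≤ 4 * η := by
      rw [ae_restrict_iff' hB]
      have : ∀ᵐ x ∂ν, x ∉ B ∩ {x | G n x ≤ c - η} := measure_eq_zero_iff_ae_notMem.1 h0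
      filter_upwards [this] with x hx hxB
      have h4 : ¬ (G n x ≤ c - η) := fun h => hx ⟨hxB, h⟩
      have h5 : |g x - c| < η := (hBA hxB).2
      rw [abs_lt] at h5
      push Not at h4
      rcases abs_cases (G n x - g x) with ⟨h6, _⟩ | ⟨h6, _⟩ <;> rw [h6] <;> linarith
    have := integral_mono_ae (hiB.sub hiB') (integrable_const (4 * η)) hae
    simp only [Pi.sub_apply] at this
    rw [integral_sub hiB hiB'] at this
    simp at this
    nlinarith

/-- The part of `A` where the sets indexed by the list `l` occur with the signs prescribed by `ε`;
the sign `ε i` belongs to the `i`-th entry of `l` counted from the end. -/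
def signedAtom {Ω : Type*} (S : ℕ → Bool → Set Ω) (A : Set Ω) (ε : ℕ → Bool) : List ℕ → Set Ω
  | [] => A
  | n :: l => signedAtom S A ε l ∩ S n (ε l.length)

/-- If, for `U`-most `n`, both sets of the pair `S n` meet a given subset of `A` of positive measure
in positive measure, then some sequence of pairs chosen from `S` is independent: all atoms generated
by the finitely many pairs chosen so far are split by the next one. -/
theorem exists_independentPairs_of_splitting {Ω : Type*} [MeasurableSpace Ω] (ν : Measure Ω)
    (U : Ultrafilter ℕ) (S : ℕ → Bool → Set Ω) (hS : ∀ n b, MeasurableSet (S n b)) {A : Set Ω}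
    (hA : MeasurableSet A) (hνA : 0 < ν A)
    (h : ∀ B ⊆ A, MeasurableSet B → 0 < ν B → ∀ᶠ n in (U : Filter ℕ), ∀ b, 0 < ν (B ∩ S n b)) :
    ∃ φ : ℕ → ℕ, IndependentPairs fun k => S (φ k) := by
  have hmeas : ∀ ε l, MeasurableSet (signedAtom S A ε l) := by
    intro ε l
    induction l with
    | nil => exact hA
    | cons n l ih => exact ih.inter (hS _ _)
  have hsub : ∀ ε l, signedAtom S A ε l ⊆ A := by
    intro ε l
    induction l with
    | nil => exact subset_rfl
    | cons n l ih => exact Set.inter_subset_left.trans ih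
  have hfin : ∀ l, (Set.range fun ε => signedAtom S A ε l).Finite := by
    intro l
    induction l with
    | nil => simp [signedAtom]
    | cons n l ih =>
      refine (Set.Finite.image2 (fun B b => B ∩ S n b) ih
        (Set.finite_univ (α := Bool))).subset ?_
      rintro _ ⟨ε, rfl⟩
      exact ⟨_, ⟨ε, rfl⟩, ε l.length, trivial, rfl⟩
  let State := {l : List ℕ // ∀ ε, 0 < ν (signedAtom S A ε l)}
  have step : ∀ s : State, ∃ n, ∀ ε, 0 < ν (signedAtom S A ε (n :: s.1)) := by
    rintro ⟨l, hl⟩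
    have : ∀ᶠ n in (U : Filter ℕ), ∀ B ∈ Set.range fun ε => signedAtom S A ε l,
        ∀ b, 0 < ν (B ∩ S n b) := by
      rw [Filter.eventually_all_finite (hfin l)]
      rintro _ ⟨ε, rfl⟩
      exact h _ (hsub _ _) (hmeas _ _) (hl ε)
    obtain ⟨n, hn⟩ := this.exists
    exact ⟨n, fun ε => hn _ ⟨ε, rfl⟩ _⟩
  choose next hnext using step
  let s : ℕ → State := fun k =>
    Nat.rec ⟨[], fun _ => hνA⟩ (fun _ t => ⟨next t :: t.1, hnext t⟩) k
  have hs : ∀ k, (s (k + 1)).1 = next (s k) :: (s k).1 := fun k => rfl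
  have hlen : ∀ k, (s k).1.length = k := by
    intro k
    induction k with
    | zero => rfl
    | succ k ih => rw [hs, List.length_cons, ih]
  refine ⟨fun k => next (s k), fun m ε => ?_⟩
  obtain ⟨x, hx⟩ := nonempty_of_measure_ne_zero ((s m).2 ε).ne'
  refine ⟨x, ?_⟩
  clear_value s
  induction m with
  | zero => simp
  | succ m ih =>
    rw [hs] at hx
    intro n hn
    rcases Nat.lt_succ_iff_lt_or_eq.1 hn with h1 | rfl
    · exact ih hx.1 n h1
    · have := hx.2
      rwa [hlen] at this

/-! ### Tame families of continuous functions and `L¹`-total boundedness -/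

/-- The pair `({f ≤ p}, {q ≤ f})` of level sets of a real function, indexed by `Bool`. -/
def levelPair {S : Type*} (f : S → ℝ) (p q : ℝ) : Bool → Set S
  | false => {x | f x ≤ p}
  | true => {x | q ≤ f x}

/-- A family of continuous functions is tame if it contains no sequence whose level sets at some
fixed heights `p < q` are independent. -/
def IsTame {K : Type*} [TopologicalSpace K] (F : Set C(K, ℝ)) : Prop :=
  ∀ f : ℕ → C(K, ℝ), (∀ n, f n ∈ F) → ∀ p q : ℝ, p < q →
    ¬ IndependentPairs fun n => levelPair (f n) p q

theorem dist_toLp_one {K : Type*} [TopologicalSpace K] [CompactSpace K] [MeasurableSpace K]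
    [BorelSpace K] (ν : Measure K) [IsFiniteMeasure ν] (f g : C(K, ℝ)) :
    dist (ContinuousMap.toLp 1 ν ℝ f) (ContinuousMap.toLp 1 ν ℝ g) = ∫ x, |f x - g x| ∂ν := by
  rw [dist_eq_norm, ← map_sub, L1.norm_eq_integral_norm]
  refine integral_congr_ae ?_
  filter_upwards [ContinuousMap.coeFn_toLp (p := 1) (𝕜 := ℝ) ν (f - g)] with x hx
  rw [hx]; rfl

theorem TotallyBounded.not_separated {α : Type*} [PseudoMetricSpace α] {s : Set α}
    (hs : TotallyBounded s) {u : ℕ → α} (hu : ∀ n, u n ∈ s) {δ : ℝ} (hδ : 0 < δ) :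
    ∃ n m, n ≠ m ∧ dist (u n) (u m) < δ := by
  obtain ⟨t, ht, hst⟩ := Metric.totallyBounded_iff.1 hs (δ / 2) (half_pos hδ)
  have h : ∀ n, ∃ y ∈ t, dist (u n) y < δ / 2 := fun n => by simpa using hst (hu n)
  choose y hyt hy using h
  obtain ⟨n, -, m, -, hnm, h⟩ :=
    Set.infinite_univ.exists_ne_map_eq_of_mapsTo (f := y) (t := t) (fun n _ => hyt n) ht
  refine ⟨n, m, hnm, ?_⟩
  have h1 := hy n
  have h2 := hy m
  rw [← h, dist_comm] at h2
  linarith [dist_triangle (u n) (y n) (u m)]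

theorem totallyBounded_of_forall_not_separated {α : Type*} [PseudoMetricSpace α] {s : Set α}
    (hs : ∀ u : ℕ → α, (∀ n, u n ∈ s) → ∀ δ > 0, ∃ n m, n ≠ m ∧ dist (u n) (u m) < δ) :
    TotallyBounded s := by
  by_contra hcon
  rw [Metric.totallyBounded_iff] at hcon
  push Not at hcon
  obtain ⟨δ, hδ, h⟩ := hcon
  obtain ⟨u, hus, hu⟩ := exists_seq_of_forall_finset_exists (fun x => x ∈ s)
    (fun x y => δ ≤ dist y x) (fun t _ => by
      obtain ⟨y, hys, hy⟩ := Set.not_subset.1 (h t t.finite_toSet)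
      exact ⟨y, hys, fun x hx => not_lt.1 fun h' => hy (Set.mem_iUnion₂.2 ⟨x, hx, h'⟩)⟩)
  obtain ⟨n, m, hnm, hlt⟩ := hs u hus δ hδ
  rcases lt_or_gt_of_ne hnm with h1 | h1
  · have := hu n m h1; rw [dist_comm] at this; linarith
  · have := hu m n h1; linarith

/-- A bounded tame family is totally bounded in `L¹(ν)`, for every finite measure `ν`. -/
theorem IsTame.totallyBounded_toLp {K : Type*} [TopologicalSpace K] [CompactSpace K]
    [MeasurableSpace K] [BorelSpace K] (ν : Measure K) [IsFiniteMeasure ν] {F : Set C(K, ℝ)}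
    (hF : IsTame F) (hb : ∀ f ∈ F, ‖f‖ ≤ 1) :
    TotallyBounded (ContinuousMap.toLp 1 ν ℝ '' F) := by
  refine totallyBounded_of_forall_not_separated fun u hu δ hδ => ?_
  by_contra! hsep
  choose f hfF hfu using hu
  have hG : ∀ n, (ContinuousMap.toLp 2 ν ℝ (f n)) =ᵐ[ν] f n := fun n =>
    ContinuousMap.coeFn_toLp ν (f n)
  obtain ⟨A, c, η, hA, hη, hνA, h⟩ := exists_oscillation_set ν
    (G := fun n => ContinuousMap.toLp 2 ν ℝ (f n))
    (R := ‖(ContinuousMap.toLp 2 ν ℝ : C(K, ℝ) →L[ℝ] Lp ℝ 2 ν)‖)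
    (fun n => (ContinuousLinearMap.le_opNorm _ _).trans
      (mul_le_of_le_one_right (norm_nonneg _) (hb _ (hfF n)))) hδ
    (fun n m hnm => by
      have h1 := hsep n m hnm
      rw [← hfu, ← hfu, dist_toLp_one] at h1
      refine h1.trans (le_of_eq (integral_congr_ae ?_))
      filter_upwards [hG n, hG m] with x hx hy
      rw [hx, hy])
  obtain ⟨φ, hφ⟩ := exists_independentPairs_of_splitting ν (hyperfilter ℕ)
    (fun n => levelPair (f n) (c - η) (c + η))
    (fun n b => by
      cases b
      · exact measurableSet_le (f n).continuous.measurable measurable_const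
      · exact measurableSet_le measurable_const (f n).continuous.measurable) hA hνA
    (fun B hBA hB hνB => by
      filter_upwards [h B hBA hB hνB] with n hn b
      cases b
      · refine hn.2.trans_le (measure_mono_ae ?_)
        filter_upwards [hG n] with x hx hxB
        exact ⟨hxB.1, hx.symm.trans_le hxB.2⟩
      · refine hn.1.trans_le (measure_mono_ae ?_)
        filter_upwards [hG n] with x hx hxB
        exact ⟨hxB.1, le_of_le_of_eq hxB.2 hx⟩)
  exact hF (fun k => f (φ k)) (fun k => hfF _) _ _ (by linarith) hφ

/-! ### Sequences equivalent to the unit vectors of `ℓ¹` -/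

/-- The `ℓ¹`-norm on finitely supported families, as a seminorm. -/
noncomputable def ellOneSeminorm (α : Type*) : Seminorm ℝ (α →₀ ℝ) :=
  Seminorm.of (fun a => a.sum fun _ t => |t|)
    (fun a b => by
      classical
      have ha : a.support ⊆ a.support ∪ b.support := Finset.subset_union_left
      have hb : b.support ⊆ a.support ∪ b.support := Finset.subset_union_right
      rw [Finsupp.sum_of_support_subset _ Finsupp.support_add _ (by simp),
        Finsupp.sum_of_support_subset _ ha _ (by simp),
        Finsupp.sum_of_support_subset _ hb _ (by simp), ← Finset.sum_add_distrib]
      exact Finset.sum_le_sum fun i _ => abs_add_le _ _)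
    (fun r a => by
      rw [Finsupp.sum_smul_index (by simp), Finsupp.mul_sum]
      simp [abs_mul])

theorem ellOneSeminorm_apply {α : Type*} (a : α →₀ ℝ) :
    ellOneSeminorm α a = ∑ i ∈ a.support, |a i| := rfl

/-- The sequence `x` dominates the unit vectors of `ℓ¹`, with constant `c`, for the seminorm `N`. -/
def EllOneBelow {V : Type*} [AddCommGroup V] [Module ℝ V] (N : Seminorm ℝ V) (x : ℕ → V)
    (c : ℝ) : Prop :=
  ∀ a : ℕ →₀ ℝ, c * ellOneSeminorm ℕ a ≤ N (Finsupp.linearCombination ℝ x a)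

/-- In a weighted complete graph some cut carries at least half of the total weight. -/
theorem exists_signs_cut {ι : Type*} [Fintype ι] (t : ι → ℝ) (ht : ∑ i, t i = 1) (j k : ι → ℕ)
    (hjk : ∀ i, j i ≠ k i) :
    ∃ σ : ℕ → ℝ, (∀ l, σ l = 1 ∨ σ l = -1) ∧ 1 ≤ ∑ i, t i * (1 - σ (j i) * σ (k i)) := by
  classical
  let s : Finset ℕ := Finset.univ.image j ∪ Finset.univ.image k
  let sg : (s → Bool) → ℕ → ℝ := fun ε l => if h : l ∈ s then (if ε ⟨l, h⟩ then 1 else -1) else 1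
  have hsg : ∀ ε l, sg ε l = 1 ∨ sg ε l = -1 := by
    intro ε l; simp only [sg]; split_ifs <;> simp
  -- The signs of two distinct vertices are uncorrelated: flip the first one.
  have hzero : ∀ i, ∑ ε, sg ε (j i) * sg ε (k i) = 0 := by
    intro i
    have hj : j i ∈ s := by simp [s]
    let flip : (s → Bool) → (s → Bool) := fun ε => Function.update ε ⟨j i, hj⟩ (!ε ⟨j i, hj⟩)
    have hinv : Function.Involutive flip := by
      intro ε; ext l; by_cases h : l = ⟨j i, hj⟩ <;> simp [flip, h]
    have h1 : ∀ ε, sg (flip ε) (j i) * sg (flip ε) (k i) = -(sg ε (j i) * sg ε (k i)) := by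
      intro ε
      have h2 : sg (flip ε) (j i) = - sg ε (j i) := by
        simp only [sg, hj, dif_pos, flip, Function.update_self]
        cases ε ⟨j i, hj⟩ <;> simp
      have h3 : sg (flip ε) (k i) = sg ε (k i) := by
        simp only [sg, flip]
        split_ifs with h <;> first | rfl | skip
        all_goals simp_all [Function.update_of_ne, Subtype.ext_iff, (hjk i).symm]
      rw [h2, h3]; ring
    have h4 := Equiv.sum_comp hinv.toPerm (fun ε => sg ε (j i) * sg ε (k i))
    simp only [Function.Involutive.coe_toPerm, h1, Finset.sum_neg_distrib] at h4
    linarith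
  obtain ⟨ε, -, hε⟩ := Finset.exists_le_of_sum_le (s := (Finset.univ : Finset (s → Bool)))
    (f := fun _ => (1 : ℝ)) (g := fun ε => ∑ i, t i * (1 - sg ε (j i) * sg ε (k i)))
    Finset.univ_nonempty (by
      rw [Finset.sum_comm]
      simp_rw [← Finset.mul_sum, Finset.sum_sub_distrib, hzero, sub_zero, ← Finset.sum_mul, ht,
        one_mul]
      exact le_rfl)
  exact ⟨sg ε, hsg ε, hε⟩

/-- Every convex combination of the functions `|g j - g k|` has large values somewhere, if `g` is an
`ℓ¹`-sequence in `C(K)`. -/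
theorem EllOneBelow.exists_le_of_mem_convexHull {K : Type*} [TopologicalSpace K] [CompactSpace K]
    {g : ℕ → C(K, ℝ)} {δ : ℝ} (hδ : 0 < δ) (hg : EllOneBelow (normSeminorm ℝ C(K, ℝ)) g δ)
    {u : C(K, ℝ)} (hu : u ∈ convexHull ℝ {v | ∃ j k, j ≠ k ∧ v = |g j - g k|}) :
    ∃ x, δ ≤ u x := by
  obtain ⟨ι, _, t, z, ht0, ht1, hz, rfl⟩ := mem_convexHull_iff_exists_fintype.1 hu
  choose j k hjk hz using hz
  obtain ⟨σ, hσ, hcut⟩ := exists_signs_cut t ht1 j k hjk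
  have hσσ : ∀ l, σ l * σ l = 1 := fun l => by rcases hσ l with h | h <;> rw [h] <;> norm_num
  let a : ℕ →₀ ℝ := ∑ i, (t i * ((σ (j i) - σ (k i)) / 2)) •
    (Finsupp.single (j i) 1 - Finsupp.single (k i) 1)
  have hpair : ∑ i, t i * (1 - σ (j i) * σ (k i)) = Finsupp.linearCombination ℝ σ a := by
    simp only [a, map_sum, map_smul, map_sub, Finsupp.linearCombination_single, smul_eq_mul,
      one_mul]
    refine Finset.sum_congr rfl fun i _ => ?_
    have h1 := hσσ (j i)
    have h2 := hσσ (k i)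
    linear_combination (-(t i) / 2) * h1 - (t i / 2) * h2
  have hle : Finsupp.linearCombination ℝ σ a ≤ ellOneSeminorm ℕ a := by
    rw [Finsupp.linearCombination_apply, ellOneSeminorm_apply, Finsupp.sum]
    refine Finset.sum_le_sum fun l _ => ?_
    rcases hσ l with h | h <;> rw [h]
    · simpa using le_abs_self (a l)
    · simpa using neg_le_abs (a l)
  have hnorm : δ ≤ ‖Finsupp.linearCombination ℝ g a‖ := by
    have := hg a
    rw [coe_normSeminorm] at this
    nlinarith
  by_contra! hcon
  refine absurd hnorm (not_le.2 ((ContinuousMap.norm_lt_iff _ hδ).2 fun x => ?_))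
  refine lt_of_le_of_lt ?_ (hcon x)
  simp only [a, map_sum, map_smul, map_sub, Finsupp.linearCombination_single, one_smul,
    ContinuousMap.coe_sum, Finset.sum_apply, ContinuousMap.coe_smul, Pi.smul_apply,
    ContinuousMap.coe_sub, Pi.sub_apply, smul_eq_mul, Real.norm_eq_abs]
  refine (Finset.abs_sum_le_sum_abs _ _).trans (Finset.sum_le_sum fun i _ => ?_)
  rw [hz i, abs_mul, abs_mul, abs_of_nonneg (ht0 i), mul_assoc]
  refine mul_le_mul_of_nonneg_left ?_ (ht0 i)
  refine mul_le_of_le_one_left (abs_nonneg _) ?_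
  rcases hσ (j i) with h | h <;> rcases hσ (k i) with h' | h' <;> rw [h, h'] <;> norm_num

/-- A positive functional on `C(K)` is integration against a finite measure. -/
theorem exists_measure_of_positive {K : Type*} [TopologicalSpace K] [CompactSpace K] [T2Space K]
    [MeasurableSpace K] [BorelSpace K] (φ : C(K, ℝ) →L[ℝ] ℝ) (hφ : ∀ u, 0 ≤ u → 0 ≤ φ u) :
    ∃ ν : Measure K, IsFiniteMeasure ν ∧ ∀ u : C(K, ℝ), ∫ x, u x ∂ν = φ u := by
  let Λ : CompactlySupportedContinuousMap K ℝ →ₚ[ℝ] ℝ := PositiveLinearMap.mk₀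
    { toFun := fun u => φ u.toContinuousMap
      map_add' := fun u v => φ.map_add _ _
      map_smul' := fun c u => φ.map_smul _ _ } fun u hu => hφ _ hu
  refine ⟨RealRMK.rieszMeasure Λ, ⟨?_⟩, fun u => ?_⟩
  · have : IsFiniteMeasureOnCompacts (RealRMK.rieszMeasure Λ) := by
      unfold RealRMK.rieszMeasure; infer_instance
    exact isCompact_univ.measure_lt_top
  · exact RealRMK.integral_rieszMeasure Λ (CompactlySupportedContinuousMap.continuousMapEquiv u)

/-- An `ℓ¹`-sequence in `C(K)` is separated in `L¹(ν)` for a suitable finite measure `ν`. -/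
theorem EllOneBelow.exists_measure_separated {K : Type*} [TopologicalSpace K] [CompactSpace K]
    [T2Space K] [MeasurableSpace K] [BorelSpace K] {g : ℕ → C(K, ℝ)} {δ : ℝ} (hδ : 0 < δ)
    (hg : EllOneBelow (normSeminorm ℝ C(K, ℝ)) g δ) :
    ∃ (ν : Measure K) (s : ℝ), IsFiniteMeasure ν ∧ 0 < s ∧
      ∀ j k, j ≠ k → s ≤ ∫ x, |g j x - g k x| ∂ν := by
  let O : Set C(K, ℝ) := {u | ∀ x, u x < δ}
  have hO : IsOpen O := by
    have := ContinuousMap.isOpen_setOfPred_mapsTo (X := K) (Y := ℝ) isCompact_univ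
      (isOpen_Iio (a := δ))
    simpa [Set.MapsTo, O] using this
  have hOc : Convex ℝ O := by
    intro u hu v hv a b ha hb hab x
    exact (convex_Iio δ) (hu x) (hv x) ha hb hab
  obtain ⟨φ, s, hφO, hφP⟩ := geometric_hahn_banach_open hOc hO
    (convex_convexHull ℝ {v | ∃ j k, j ≠ k ∧ v = |g j - g k|})
    (Set.disjoint_left.2 fun u hu hu' => by
      obtain ⟨x, hx⟩ := hg.exists_le_of_mem_convexHull hδ hu'
      exact absurd (hu x) (not_lt.2 hx))
  have hs : 0 < s := by simpa using hφO 0 (fun x => by simpa using hδ)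
  have hpos : ∀ u, 0 ≤ u → 0 ≤ φ u := by
    intro u hu
    by_contra! hneg
    have h1 : (s / φ u) • u ∈ O := fun x => by
      have : s / φ u ≤ 0 := div_nonpos_of_nonneg_of_nonpos hs.le hneg.le
      have hux : 0 ≤ u x := hu x
      simp only [ContinuousMap.coe_smul, Pi.smul_apply, smul_eq_mul]
      nlinarith
    have := hφO _ h1
    rw [map_smul, smul_eq_mul, div_mul_cancel₀ _ hneg.ne] at this
    exact lt_irrefl _ this
  obtain ⟨ν, hν, hint⟩ := exists_measure_of_positive φ hpos
  refine ⟨ν, s, hν, hs, fun j k hjk => ?_⟩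
  exact (hφP _ (subset_convexHull ℝ _ ⟨j, k, hjk, rfl⟩)).trans_eq (hint _).symm

/-! ### Interpolation between two seminorms -/

/-- The `n`-th interpolation seminorm `v ↦ inf_w (2⁻ⁿ p w + 2ⁿ q (v - w))`: the infimum of two
seminorms in the lattice of seminorms is their infimal convolution. -/
noncomputable def interpLevel {V : Type*} [AddCommGroup V] [Module ℝ V] (p q : Seminorm ℝ V)
    (n : ℕ) : Seminorm ℝ V :=
  (((2 : ℝ≥0) ^ n)⁻¹ • p) ⊓ ((2 : ℝ≥0) ^ n • q)

/-- The interpolation seminorm of Davis, Figiel, Johnson and Pełczyński, with a supremum in place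
of an `ℓ²`-sum. The levels tend to `0` at every vector, so this is a diagonal of a `c₀`-sum. -/
noncomputable def interpSeminorm {V : Type*} [AddCommGroup V] [Module ℝ V] (p q : Seminorm ℝ V) :
    Seminorm ℝ V :=
  ⨆ n, interpLevel p q n

section Interpolation

variable {V : Type*} [AddCommGroup V] [Module ℝ V] {p q : Seminorm ℝ V}

theorem interpLevel_le_left (n : ℕ) (v : V) : interpLevel p q n v ≤ ((2 : ℝ) ^ n)⁻¹ * p v :=
  (inf_le_left : interpLevel p q n ≤ _) v

theorem interpLevel_le_right (n : ℕ) (v : V) : interpLevel p q n v ≤ (2 : ℝ) ^ n * q v :=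
  (inf_le_right : interpLevel p q n ≤ _) v

theorem interpLevel_le (n : ℕ) : interpLevel p q n ≤ p := fun v => by
  refine (interpLevel_le_left n v).trans (mul_le_of_le_one_left (apply_nonneg _ _) ?_)
  exact inv_le_one_of_one_le₀ (one_le_pow₀ (by norm_num))

theorem bddAbove_range_interpLevel : BddAbove (Set.range (interpLevel p q)) :=
  ⟨p, by rintro _ ⟨n, rfl⟩; exact interpLevel_le n⟩

theorem interpLevel_le_interpSeminorm (n : ℕ) (v : V) :
    interpLevel p q n v ≤ interpSeminorm p q v :=
  (le_ciSup bddAbove_range_interpLevel n : interpLevel p q n ≤ _) v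

theorem interpSeminorm_le {v : V} {r : ℝ} (h : ∀ n, interpLevel p q n v ≤ r) :
    interpSeminorm p q v ≤ r := by
  rw [interpSeminorm, Seminorm.iSup_apply bddAbove_range_interpLevel]
  exact ciSup_le h

theorem le_interpSeminorm (hqp : q ≤ p) (v : V) : q v ≤ interpSeminorm p q v := by
  refine le_trans ?_ (interpLevel_le_interpSeminorm 0 v)
  have : q ≤ interpLevel p q 0 := by simpa [interpLevel] using hqp
  exact this v

theorem exists_add_lt_of_interpSeminorm_lt {v : V} {r : ℝ} (h : interpSeminorm p q v < r) (n : ℕ) :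
    ∃ w, ((2 : ℝ) ^ n)⁻¹ * p w + (2 : ℝ) ^ n * q (v - w) < r := by
  have h1 := (interpLevel_le_interpSeminorm n v).trans_lt h
  rw [interpLevel, Seminorm.inf_apply] at h1
  exact exists_lt_of_ciInf_lt h1

theorem Seminorm.linearCombination_le {N : Seminorm ℝ V} {x : ℕ → V} {B : ℝ}
    (hx : ∀ k, N (x k) ≤ B) (a : ℕ →₀ ℝ) :
    N (Finsupp.linearCombination ℝ x a) ≤ ellOneSeminorm ℕ a * B := by
  rw [Finsupp.linearCombination_apply, Finsupp.sum, ellOneSeminorm_apply, Finset.sum_mul]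
  refine (Finset.le_sum_of_subadditive N (map_zero N).le (map_add_le_add N) _ _).trans
    (Finset.sum_le_sum fun i _ => ?_)
  rw [map_smul_eq_mul, Real.norm_eq_abs]
  exact mul_le_mul_of_nonneg_left (hx i) (abs_nonneg _)

theorem ellOneSeminorm_add_of_disjoint {α : Type*} {a b : α →₀ ℝ}
    (h : Disjoint a.support b.support) :
    ellOneSeminorm α (a + b) = ellOneSeminorm α a + ellOneSeminorm α b := by
  classical
  rw [ellOneSeminorm_apply, Finsupp.support_add_eq h, Finset.sum_union h, ellOneSeminorm_apply,
    ellOneSeminorm_apply]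
  congr 1 <;> refine Finset.sum_congr rfl fun i hi => ?_
  · simp [Finsupp.notMem_support_iff.1 (Finset.disjoint_left.1 h hi)]
  · simp [Finsupp.notMem_support_iff.1 (Finset.disjoint_right.1 h hi)]

/-- A sequence without tails equivalent to `ℓ¹` for `q` has normalized blocks, supported beyond any
index, that are small for `q`. -/
theorem exists_small_block {x : ℕ → V} (hx : ∀ m, ∀ δ > 0, ¬ EllOneBelow q (fun k => x (k + m)) δ)
    (m : ℕ) {δ : ℝ} (hδ : 0 < δ) :
    ∃ b : ℕ →₀ ℝ, (∀ k ∈ b.support, m ≤ k) ∧ ellOneSeminorm ℕ b = 1 ∧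
      q (Finsupp.linearCombination ℝ x b) < δ := by
  have h := hx m δ hδ
  simp only [EllOneBelow, not_forall, not_le] at h
  obtain ⟨a, ha⟩ := h
  have hinj : Function.Injective fun k : ℕ => k + m := fun _ _ h => Nat.add_right_cancel h
  set b := a.embDomain ⟨_, hinj⟩ with hb
  have hbn : ellOneSeminorm ℕ b = ellOneSeminorm ℕ a := by
    rw [ellOneSeminorm_apply, ellOneSeminorm_apply, hb, Finsupp.support_embDomain, Finset.sum_map]
    exact Finset.sum_congr rfl fun i _ => by rw [Finsupp.embDomain_apply_self]
  have hbl : Finsupp.linearCombination ℝ x b = Finsupp.linearCombination ℝ (fun k => x (k + m)) a :=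
    by rw [hb, Finsupp.linearCombination_embDomain]; rfl
  have hpos : 0 < ellOneSeminorm ℕ a :=
    pos_of_mul_pos_right ((apply_nonneg _ _).trans_lt ha) hδ.le
  refine ⟨(ellOneSeminorm ℕ a)⁻¹ • b, fun k hk => ?_, ?_, ?_⟩
  · have : k ∈ b.support := Finsupp.support_smul hk
    rw [hb, Finsupp.support_embDomain, Finset.mem_map] at this
    obtain ⟨i, -, rfl⟩ := this
    exact Nat.le_add_left m i
  · rw [map_smul_eq_mul, hbn, norm_inv, Real.norm_of_nonneg hpos.le, inv_mul_cancel₀ hpos.ne']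
  · rw [map_smul, map_smul_eq_mul, hbl, norm_inv, Real.norm_of_nonneg hpos.le, inv_mul_lt_iff₀ hpos,
      mul_comm]
    exact ha

/-- The interpolation seminorm has a bounded `ℓ¹`-sequence only if `q` has an `ℓ¹`-sequence which is
bounded for the interpolation seminorm. Otherwise a gliding hump, through blocks that are small for
more and more of the levels, gives long `ℓ¹`-combinations with bounded interpolation seminorm. -/
theorem not_ellOneBelow_interpSeminorm
    (h : ∀ (x : ℕ → V) (B δ : ℝ), (∀ k, interpSeminorm p q (x k) ≤ B) → 0 < δ →
      ¬ EllOneBelow q x δ)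
    {x : ℕ → V} {B c : ℝ} (hx : ∀ k, interpSeminorm p q (x k) ≤ B) (hc : 0 < c) :
    ¬ EllOneBelow (interpSeminorm p q) x c := by
  intro hell
  have hB : 0 ≤ B := (apply_nonneg _ _).trans (hx 0)
  have key : ∀ i : ℕ, ∃ a : ℕ →₀ ℝ, ellOneSeminorm ℕ a = i ∧
      interpSeminorm p q (Finsupp.linearCombination ℝ x a) ≤ (1 + B) + i * (c / 2) := by
    intro i
    induction i with
    | zero => exact ⟨0, by simp, by simp; positivity⟩
    | succ i ih =>
      obtain ⟨a, ha, haN⟩ := ih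
      set s := Finsupp.linearCombination ℝ x a with hs
      obtain ⟨M, hM⟩ : ∃ M : ℕ, p s ≤ 2 ^ M := pow_unbounded_of_one_lt (p s) (by norm_num :
        (1 : ℝ) < 2) |>.imp fun _ h => h.le
      obtain ⟨m, hm⟩ : ∃ m, ∀ k ∈ a.support, k < m :=
        ⟨a.support.sup id + 1, fun k hk => Nat.lt_succ_of_le (Finset.le_sup (f := id) hk)⟩
      obtain ⟨b, hbm, hb1, hbq⟩ := exists_small_block
        (fun m δ hδ => h _ B δ (fun k => hx (k + m)) hδ) m (δ := c / 2 / 2 ^ M) (by positivity)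
      refine ⟨a + b, ?_, interpSeminorm_le fun n => ?_⟩
      · rw [ellOneSeminorm_add_of_disjoint, ha, hb1]
        · push_cast; ring
        · exact Finset.disjoint_left.2 fun k h1 h2 => absurd (hm k h1) (not_lt.2 (hbm k h2))
      · rw [map_add]
        refine (map_add_le_add _ _ _).trans ?_
        push_cast
        rcases le_total n M with hn | hn
        · have h1 := (interpLevel_le_interpSeminorm n s).trans haN
          have h2 : interpLevel p q n (Finsupp.linearCombination ℝ x b) ≤ c / 2 := by
            refine (interpLevel_le_right n _).trans ?_
            calc (2 : ℝ) ^ n * q (Finsupp.linearCombination ℝ x b)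
                ≤ 2 ^ M * (c / 2 / 2 ^ M) := by
                  gcongr
                  norm_num
              _ = c / 2 := by field_simp
          linarith
        · have h1 : interpLevel p q n s ≤ 1 := by
            refine (interpLevel_le_left n s).trans ?_
            rw [inv_mul_le_iff₀ (by positivity), mul_one]
            exact hM.trans (pow_le_pow_right₀ (by norm_num) hn)
          have h2 := (interpLevel_le_interpSeminorm n _).trans
            (Seminorm.linearCombination_le (N := interpSeminorm p q) hx b)
          rw [hb1, one_mul] at h2
          have : 0 ≤ ((i : ℝ) + 1) * (c / 2) := by positivity
          linarith
  obtain ⟨i, hi⟩ := exists_nat_gt ((1 + B) / (c / 2))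
  obtain ⟨a, ha, haN⟩ := key i
  have h1 := (hell a).trans haN
  rw [ha] at h1
  rw [div_lt_iff₀ (by positivity)] at hi
  linarith

end Interpolation

/-! ### Spaces without copies of `ℓ¹` -/

/-- The completion of a seminormed space without bounded `ℓ¹`-sequences does not contain `ℓ¹`: the
images of the unit vectors of `ℓ¹` can be perturbed into the dense subspace. -/
theorem not_containsEllOne_completion {V : Type*} [SeminormedAddCommGroup V] [NormedSpace ℝ V]
    (h : ∀ (x : ℕ → V) (B c : ℝ), (∀ k, ‖x k‖ ≤ B) → 0 < c → ¬ EllOneBelow (normSeminorm ℝ V) x c) :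
    ¬ ContainsEllOne (UniformSpace.Completion V) := by
  rintro ⟨T, c, hc, hT⟩
  let e : ℕ → lp (fun _ : ℕ => ℝ) 1 := fun k => lp.single 1 k 1
  have happrox : ∀ k, ∃ v : V, ‖T (e k) - (v : UniformSpace.Completion V)‖ < c / 2 := by
    intro k
    obtain ⟨_, ⟨v, rfl⟩, hv⟩ := Metric.mem_closure_iff.1
      (UniformSpace.Completion.denseRange_coe (T (e k))) (c / 2) (half_pos hc)
    exact ⟨v, by rwa [dist_eq_norm] at hv⟩
  choose x hx using happrox
  refine h x (‖T‖ + c / 2) (c / 2) (fun k => ?_) (half_pos hc) fun a => ?_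
  · rw [← UniformSpace.Completion.norm_coe]
    have h1 : ‖e k‖ = 1 := by simp [e, lp.norm_single]
    have h2 := T.le_opNorm (e k)
    rw [h1, mul_one] at h2
    have h3 := norm_sub_norm_le (x k : UniformSpace.Completion V) (T (e k))
    rw [norm_sub_rev] at h3
    linarith [hx k]
  · have hnorm : ‖Finsupp.linearCombination ℝ e a‖ = ellOneSeminorm ℕ a := by
      have h1 := lp.norm_sum_single (p := 1) (E := fun _ : ℕ => ℝ) (by norm_num) a a.support
      simp only [ENNReal.toReal_one, Real.rpow_one] at h1
      rw [ellOneSeminorm_apply, Finsupp.linearCombination_apply, Finsupp.sum]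
      refine Eq.trans (congrArg _ (Finset.sum_congr rfl fun k _ => ?_)) h1
      ext j
      by_cases hj : j = k
      · subst hj; simp [e]
      · simp [e, hj]
    have hdiff : ‖T (Finsupp.linearCombination ℝ e a) -
        ((Finsupp.linearCombination ℝ x a : V) : UniformSpace.Completion V)‖ ≤
        ellOneSeminorm ℕ a * (c / 2) := by
      have h2 : T (Finsupp.linearCombination ℝ e a) -
          ((Finsupp.linearCombination ℝ x a : V) : UniformSpace.Completion V) =
          Finsupp.linearCombination ℝ
            (fun k => T (e k) - (x k : UniformSpace.Completion V)) a := by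
        have h3 : ((Finsupp.linearCombination ℝ x a : V) : UniformSpace.Completion V) =
            UniformSpace.Completion.toComplₗᵢ (𝕜 := ℝ) (Finsupp.linearCombination ℝ x a) := rfl
        rw [h3]
        simp only [Finsupp.linearCombination_apply, Finsupp.sum, map_sum, map_smul, smul_sub,
          Finset.sum_sub_distrib]
        rfl
      rw [h2]
      exact Seminorm.linearCombination_le (N := normSeminorm ℝ (UniformSpace.Completion V))
        (fun k => (hx k).le) a
    have h4 := hT (Finsupp.linearCombination ℝ e a)
    rw [hnorm] at h4
    rw [coe_normSeminorm, ← UniformSpace.Completion.norm_coe]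
    have h5 := norm_sub_norm_le (T (Finsupp.linearCombination ℝ e a))
      ((Finsupp.linearCombination ℝ x a : V) : UniformSpace.Completion V)
    linarith

/-- A bounded sequence that dominates the unit vectors of `ℓ¹` spans a copy of `ℓ¹`. -/
theorem EllOneBelow.containsEllOne {X : Type*} [NormedAddCommGroup X] [NormedSpace ℝ X]
    [CompleteSpace X] {x : ℕ → X} {B c : ℝ} (hB : ∀ k, ‖x k‖ ≤ B) (hc : 0 < c)
    (h : EllOneBelow (normSeminorm ℝ X) x c) : ContainsEllOne X := by
  have hB0 : 0 ≤ B := (norm_nonneg _).trans (hB 0)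
  have hsn : ∀ a : lp (fun _ : ℕ => ℝ) 1, HasSum (fun k => |a k|) ‖a‖ := fun a => by
    simpa using lp.hasSum_norm (p := 1) (by norm_num) a
  have hle : ∀ (a : lp (fun _ : ℕ => ℝ) 1) k, ‖a k • x k‖ ≤ |a k| * B := fun a k => by
    rw [norm_smul, Real.norm_eq_abs]
    exact mul_le_mul_of_nonneg_left (hB k) (abs_nonneg _)
  have hsum : ∀ a : lp (fun _ : ℕ => ℝ) 1, Summable fun k => a k • x k := fun a =>
    .of_norm_bounded ((hsn a).summable.mul_right B) (hle a)
  let T : lp (fun _ : ℕ => ℝ) 1 →ₗ[ℝ] X :=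
    { toFun := fun a => ∑' k, a k • x k
      map_add' := fun a b => by
        rw [← (hsum a).tsum_add (hsum b)]
        simp [add_smul]
      map_smul' := fun r a => by
        rw [RingHom.id_apply, ← (hsum a).tsum_const_smul]
        simp [mul_smul] }
  refine ⟨T.mkContinuous B fun a => ?_, c, hc, fun a => ?_⟩
  · rw [mul_comm]
    exact tsum_of_norm_bounded ((hsn a).mul_right B) (hle a)
  · refine le_of_tendsto_of_tendsto ((hsn a).mul_left c) (hsum a).hasSum.norm
      (Eventually.of_forall fun s => ?_)
    have h1 := h (∑ k ∈ s, Finsupp.single k (a k))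
    have h2 : ∀ k, (∑ i ∈ s, Finsupp.single i (a i) : ℕ →₀ ℝ) k = if k ∈ s then a k else 0 :=
      fun k => by simp [Finsupp.finsetSum_apply, Finsupp.single_apply]
    have h3 : ellOneSeminorm ℕ (∑ k ∈ s, Finsupp.single k (a k)) = ∑ k ∈ s, |a k| := by
      rw [ellOneSeminorm_apply, Finset.sum_subset (s₂ := s)]
      · exact Finset.sum_congr rfl fun k hk => by rw [h2, if_pos hk]
      · intro k hk
        by_contra hks
        rw [Finsupp.mem_support_iff, h2, if_neg hks] at hk
        exact hk rfl
      · intro k _ hk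
        rw [Finsupp.notMem_support_iff.1 hk, abs_zero]
    rw [h3, map_sum] at h1
    simp only [Finsupp.linearCombination_single, coe_normSeminorm, Finset.mul_sum] at h1
    exact h1

/-! ### Tame separating families characterize weakly Radon–Nikodým compacta -/

theorem AbsConvex.linearCombination_mem {E ι : Type*} [AddCommGroup E] [Module ℝ E] {A : Set E}
    (hA : AbsConvex ℝ A) (h0 : (0 : E) ∈ A) {z : ι → E} (hz : ∀ i, z i ∈ A) {a : ι →₀ ℝ}
    (ha : ellOneSeminorm ι a ≤ 1) : Finsupp.linearCombination ℝ z a ∈ A := by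
  rcases (apply_nonneg (ellOneSeminorm ι) a).eq_or_lt with h | h
  · have : a = 0 := by
      ext i
      by_contra hi
      have h1 := Finset.single_le_sum (f := fun i => |a i|) (fun i _ => abs_nonneg _)
        (Finsupp.mem_support_iff.2 hi)
      rw [← ellOneSeminorm_apply, ← h] at h1
      exact hi (abs_nonpos_iff.1 h1)
    simpa [this] using h0
  · set r := ellOneSeminorm ι a with hr
    have h1 : ∑ i ∈ a.support, (|a i| / r) • (SignType.sign (a i) : ℝ) • z i ∈ A := by
      refine hA.2.sum_mem (fun i _ => by positivity) ?_ fun i _ => ?_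
      · rw [← Finset.sum_div, ← ellOneSeminorm_apply, ← hr, div_self h.ne']
      · refine hA.1.smul_mem ?_ (hz i)
        rcases lt_trichotomy (a i) 0 with h | h | h <;> simp [h]
    have h2 := hA.1.smul_mem (a := r) (by rwa [Real.norm_of_nonneg h.le]) h1
    convert h2 using 1
    rw [Finsupp.linearCombination_apply, Finsupp.sum, Finset.smul_sum]
    refine Finset.sum_congr rfl fun i _ => ?_
    rw [smul_smul, smul_smul, mul_div_cancel₀ _ h.ne', abs_mul_sign]

/-- A linear map into `C(K)` whose range separates the points of `K`, bounded for a seminorm without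
bounded `ℓ¹`-sequences, embeds `K` into the dual of the completion. -/
theorem isWRN_of_seminorm {K V : Type u} [TopologicalSpace K] [CompactSpace K]
    [AddCommGroup V] [Module ℝ V] (N : Seminorm ℝ V) (T : V →ₗ[ℝ] C(K, ℝ))
    (hT : ∀ v, ‖T v‖ ≤ N v) (hsep : ∀ x y, x ≠ y → ∃ v, T v x ≠ T v y)
    (hN : ∀ (x : ℕ → V) (B c : ℝ), (∀ k, N (x k) ≤ B) → 0 < c → ¬ EllOneBelow N x c) :
    IsWRN K := by
  let _ : SeminormedAddCommGroup V := AddGroupSeminorm.toSeminormedAddCommGroup N.toAddGroupSeminorm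
  let _ : NormedSpace ℝ V := ⟨fun r v => (map_smul_eq_mul N r v).le⟩
  have hnorm : normSeminorm ℝ V = N := rfl
  let e : V →ₗ[ℝ] UniformSpace.Completion V :=
    (UniformSpace.Completion.toComplₗᵢ (𝕜 := ℝ) (E := V)).toLinearMap
  have hTe : ∀ v, T.extendOfNorm e (e v) = T v :=
    LinearMap.extendOfNorm_eq UniformSpace.Completion.denseRange_coe
      ⟨1, fun v => by
        rw [one_mul]
        exact (hT v).trans_eq (UniformSpace.Completion.norm_coe v).symm⟩
  let j : K → WeakDual ℝ (UniformSpace.Completion V) := fun x =>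
    StrongDual.toWeakDual ((ContinuousMap.evalCLM ℝ x).comp (T.extendOfNorm e))
  have hj : ∀ x v, j x v = T.extendOfNorm e v x := fun x v => rfl
  have hjc : Continuous j := WeakDual.continuous_of_continuous_eval fun v => by
    simp only [hj]
    exact (T.extendOfNorm e v).continuous
  have hji : Function.Injective j := by
    intro x y hxy
    by_contra hne
    obtain ⟨v, hv⟩ := hsep x y hne
    have h1 := DFunLike.congr_fun hxy (e v)
    rw [hj, hj, hTe] at h1
    exact hv h1
  exact ⟨UniformSpace.Completion V, inferInstance, inferInstance, inferInstance,
    not_containsEllOne_completion hN, Set.range j, isCompact_range hjc,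
    ⟨(hjc.isClosedEmbedding hji).isEmbedding.toHomeomorph⟩⟩

/-- A compact space is weakly Radon–Nikodým if it has a bounded tame family of continuous functions
separating its points. The predual is the interpolation space between the span of the family, with
its `ℓ¹`-norm, and `C(K)`; its unit ball is, up to small errors, in multiples of
the absolutely convex hull of the family, hence totally bounded in `L¹(ν)` for every `ν`. -/
theorem IsTame.isWRN {K : Type u} [TopologicalSpace K] [CompactSpace K] [T2Space K]
    {F : Set C(K, ℝ)} (hF : IsTame F) (hb : ∀ f ∈ F, ‖f‖ ≤ 1)
    (hsep : ∀ x y, x ≠ y → ∃ f ∈ F, f x ≠ f y) : IsWRN K := by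
  let T : (F →₀ ℝ) →ₗ[ℝ] C(K, ℝ) := Finsupp.linearCombination ℝ Subtype.val
  let p := ellOneSeminorm F
  let q := (normSeminorm ℝ C(K, ℝ)).comp T
  have hqp : q ≤ p := fun v => by
    change ‖T v‖ ≤ ellOneSeminorm F v
    rw [ellOneSeminorm_apply, Finsupp.linearCombination_apply, Finsupp.sum]
    refine (norm_sum_le _ _).trans (Finset.sum_le_sum fun f _ => ?_)
    rw [norm_smul, Real.norm_eq_abs]
    exact mul_le_of_le_one_right (abs_nonneg _) (hb _ f.2)
  refine isWRN_of_seminorm (interpSeminorm p q) T (le_interpSeminorm hqp) (fun x y hxy => ?_)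
    fun x B c hx hc => not_ellOneBelow_interpSeminorm (fun x B δ hx hδ hell => ?_) hx hc
  · obtain ⟨f, hf, hfxy⟩ := hsep x y hxy
    exact ⟨Finsupp.single ⟨f, hf⟩ 1, by simpa [T] using hfxy⟩
  let _ : MeasurableSpace K := borel K
  have : BorelSpace K := ⟨rfl⟩
  have hg : EllOneBelow (normSeminorm ℝ C(K, ℝ)) (fun k => T (x k)) δ := fun a => by
    have h1 : Finsupp.linearCombination ℝ (fun k => T (x k)) a =
        T (Finsupp.linearCombination ℝ x a) := by
      rw [Finsupp.apply_linearCombination]; rfl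
    rw [h1]
    exact hell a
  obtain ⟨ν, s, hν, hs, hsep⟩ := hg.exists_measure_separated hδ
  let Φ : C(K, ℝ) →L[ℝ] Lp ℝ 1 ν := ContinuousMap.toLp 1 ν ℝ
  have hB : 0 ≤ B := (apply_nonneg _ _).trans (hx 0)
  obtain ⟨n, hn⟩ : ∃ n : ℕ, 4 * (‖Φ‖ * (B + 1)) / s < 2 ^ n :=
    pow_unbounded_of_one_lt _ (by norm_num)
  have hw := fun k => exists_add_lt_of_interpSeminorm_lt ((hx k).trans_lt (lt_add_one B)) n
  choose w hw using hw
  have h2n : (0 : ℝ) < 2 ^ n := by positivity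
  set r : ℝ := 2 ^ n * (B + 1) with hr
  have hr0 : 0 < r := by positivity
  have hpw : ∀ k, p (w k) ≤ r := fun k => by
    have h1 : 0 ≤ (2 : ℝ) ^ n * q (x k - w k) := by positivity
    have h2 : ((2 : ℝ) ^ n)⁻¹ * p (w k) < B + 1 := by linarith [hw k]
    rw [inv_mul_lt_iff₀ h2n] at h2
    exact h2.le
  have hqw : ∀ k, ‖Φ (T (x k)) - Φ (T (w k))‖ ≤ s / 4 := fun k => by
    have h1 : 0 ≤ ((2 : ℝ) ^ n)⁻¹ * p (w k) := by positivity
    have h2 : (2 : ℝ) ^ n * q (x k - w k) < B + 1 := by linarith [hw k]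
    have h3 : q (x k - w k) ≤ (B + 1) / 2 ^ n := by
      rw [le_div_iff₀ h2n, mul_comm]; exact h2.le
    have h4 : ‖T (x k - w k)‖ ≤ (B + 1) / 2 ^ n := h3
    rw [← map_sub, ← map_sub]
    refine (Φ.le_opNorm _).trans ((mul_le_mul_of_nonneg_left h4 (norm_nonneg _)).trans ?_)
    rw [div_lt_iff₀ hs] at hn
    rw [← mul_div_assoc, div_le_iff₀ h2n]
    linarith
  have htb : TotallyBounded (absConvexHull ℝ (insert 0 (Φ '' F))) :=
    ((hF.totallyBounded_toLp ν hb).insert 0).absConvexHull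
  obtain ⟨i, k, hik, hlt⟩ := htb.not_separated (u := fun k => Φ (T (r⁻¹ • w k))) (fun k => by
    have h1 : Φ (T (r⁻¹ • w k)) =
        Finsupp.linearCombination ℝ (fun f : F => Φ f) (r⁻¹ • w k) := by
      have := Finsupp.apply_linearCombination ℝ Φ.toLinearMap (Subtype.val : F → C(K, ℝ))
        (r⁻¹ • w k)
      exact this
    rw [h1]
    refine absConvex_absConvexHull.linearCombination_mem
      (subset_absConvexHull (Set.mem_insert _ _))
      (fun f => subset_absConvexHull (Set.mem_insert_of_mem _ (Set.mem_image_of_mem Φ f.2))) ?_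
    rw [map_smul_eq_mul, norm_inv, Real.norm_of_nonneg hr0.le, inv_mul_le_iff₀ hr0, mul_one]
    exact hpw k) (δ := r⁻¹ * (s / 4)) (by positivity)
  have hclose : dist (Φ (T (w i))) (Φ (T (w k))) < s / 4 := by
    simp only [map_smul] at hlt
    rw [dist_smul₀, norm_inv, Real.norm_of_nonneg hr0.le] at hlt
    exact lt_of_mul_lt_mul_left hlt (by positivity)
  have hfar := hsep i k hik
  rw [← dist_toLp_one] at hfar
  have hi := hqw i
  have hk := hqw k
  rw [← dist_eq_norm] at hi hk
  rw [dist_comm] at hk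
  have h5 := dist_triangle4 (Φ (T (x i))) (Φ (T (w i))) (Φ (T (w k))) (Φ (T (x k)))
  have h6 : s ≤ dist (Φ (T (x i))) (Φ (T (x k))) := hfar
  linarith

/-- A weakly Radon–Nikodým compact space has a bounded tame family of continuous functions that
separates points: a multiple of the unit ball of the predual. Indeed functions with independent
level sets dominate the unit vectors of `ℓ¹`. -/
theorem IsWRN.exists_isTame {L : Type u} [TopologicalSpace L] (h : IsWRN L) :
    ∃ F : Set C(L, ℝ), IsTame F ∧ (∀ f ∈ F, ∀ x, |f x| ≤ 1) ∧
      ∀ x y, x ≠ y → ∃ f ∈ F, f x ≠ f y := by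
  obtain ⟨X, _, _, _, hX, S, hS, ⟨e⟩⟩ := h
  let E : L → StrongDual ℝ X := fun x => WeakDual.toStrongDual (e x).1
  have hEc : ∀ v : X, Continuous fun x => E x v := fun v =>
    (WeakDual.eval_continuous v).comp (continuous_subtype_val.comp e.continuous)
  obtain ⟨R, hR⟩ : ∃ R, ∀ x, ‖E x‖ ≤ R := banach_steinhaus fun v => by
    obtain ⟨C, hC⟩ := (hS.image (WeakDual.eval_continuous v)).isBounded.exists_norm_le
    exact ⟨C, fun x => hC _ ⟨_, (e x).2, rfl⟩⟩
  replace hR : ∀ x, ‖E x‖ ≤ |R| + 1 := fun x => (hR x).trans (by linarith [le_abs_self R])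
  have hR0 : 0 < |R| + 1 := by positivity
  generalize |R| + 1 = R at hR hR0
  refine ⟨{f | ∃ v : X, ‖v‖ ≤ R⁻¹ ∧ ∀ x, f x = E x v}, ?_, ?_, ?_⟩
  · intro f hf p q hpq hind
    choose v hv hfv using hf
    refine hX (EllOneBelow.containsEllOne (x := v) hv (c := (q - p) / (2 * R))
      (by have := sub_pos.2 hpq; positivity) fun a => ?_)
    obtain ⟨m, hm⟩ : ∃ m, ∀ k ∈ a.support, k < m :=
      ⟨a.support.sup id + 1, fun k hk => Nat.lt_succ_of_le (Finset.le_sup (f := id) hk)⟩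
    -- Compare the values at a point following the signs of `a` and one following the opposites.
    obtain ⟨x, hx⟩ := hind m fun k => decide (0 ≤ a k)
    obtain ⟨y, hy⟩ := hind m fun k => !decide (0 ≤ a k)
    have h1 : (q - p) * ellOneSeminorm ℕ a ≤
        (E x - E y) (Finsupp.linearCombination ℝ v a) := by
      rw [ellOneSeminorm_apply, Finset.mul_sum, Finsupp.linearCombination_apply, Finsupp.sum,
        map_sum]
      refine Finset.sum_le_sum fun k hk => ?_
      have hxk := hx k (hm k hk)
      have hyk := hy k (hm k hk)
      rw [map_smul, sub_apply, ← hfv, ← hfv, smul_eq_mul]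
      by_cases hak : 0 ≤ a k
      · simp only [hak, decide_true, Bool.not_true, levelPair, Set.mem_ofPred_eq] at hxk hyk
        rw [abs_of_nonneg hak]
        nlinarith
      · simp only [hak, decide_false, Bool.not_false, levelPair, Set.mem_ofPred_eq] at hxk hyk
        rw [abs_of_neg (not_le.1 hak)]
        nlinarith
    have h2 : ‖E x - E y‖ ≤ 2 * R := (norm_sub_le _ _).trans (by linarith [hR x, hR y])
    have h3 : (E x - E y) (Finsupp.linearCombination ℝ v a) ≤
        2 * R * ‖Finsupp.linearCombination ℝ v a‖ :=
      (le_abs_self _).trans (((E x - E y).le_opNorm _).trans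
        (mul_le_mul_of_nonneg_right h2 (norm_nonneg _)))
    rw [coe_normSeminorm, div_mul_eq_mul_div, div_le_iff₀ (by positivity), mul_comm _ (2 * R)]
    exact h1.trans h3
  · rintro f ⟨v, hv, hfv⟩ x
    rw [hfv, ← Real.norm_eq_abs]
    refine ((E x).le_opNorm v).trans ?_
    calc ‖E x‖ * ‖v‖ ≤ R * R⁻¹ := by gcongr; exact hR x
      _ = 1 := mul_inv_cancel₀ hR0.ne'
  · intro x y hxy
    have hne : E x ≠ E y := fun h' =>
      hxy (e.injective (Subtype.ext (WeakDual.toStrongDual.injective h')))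
    obtain ⟨v, hv⟩ : ∃ v, E x v ≠ E y v := by
      by_contra! h'
      exact hne (ContinuousLinearMap.ext h')
    set t : ℝ := R⁻¹ / (‖v‖ + 1) with ht
    have ht0 : 0 < t := by positivity
    refine ⟨⟨fun x => E x (t • v), hEc _⟩, ⟨t • v, ?_, fun _ => rfl⟩, ?_⟩
    · rw [norm_smul, Real.norm_of_nonneg ht0.le, ht, div_mul_eq_mul_div,
        div_le_iff₀ (by positivity)]
      have : 0 < R⁻¹ := by positivity
      nlinarith
    · simpa [ht0.ne'] using hv

/-! ### Independent pairs -/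

theorem IndependentPairs.comp_strictMono {S : Type*} {A : ℕ → Bool → Set S}
    (hA : IndependentPairs A) {φ : ℕ → ℕ} (hφ : StrictMono φ) :
    IndependentPairs fun n => A (φ n) := by
  intro m ε
  obtain ⟨x, hx⟩ := hA (φ m) (ε ∘ Function.invFun φ)
  refine ⟨x, fun n hn => ?_⟩
  have := hx (φ n) (hφ hn)
  rwa [Function.comp_apply, Function.leftInverse_invFun hφ.injective] at this

theorem IndependentPairs.mono {S : Type*} {A A' : ℕ → Bool → Set S} (hA : IndependentPairs A)
    (h : ∀ n b, A n b ⊆ A' n b) : IndependentPairs A' := fun m ε =>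
  (hA m ε).imp fun _ hx n hn => h n _ (hx n hn)

theorem IndependentPairs.exists_mem_inter {S : Type*} {A : ℕ → Bool → Set S}
    (hA : IndependentPairs A) {n m : ℕ} (hnm : n ≠ m) : ∃ x, x ∈ A n false ∧ x ∈ A m true := by
  obtain ⟨x, hx⟩ := hA (n + m + 1) fun k => decide (k = m)
  refine ⟨x, ?_, ?_⟩
  · simpa [hnm] using hx n (by lia)
  · simpa using hx m (by lia)

theorem levelPair_disjoint {S : Type*} (f : S → ℝ) {p q : ℝ} (hpq : p < q) {x : S}
    (h1 : x ∈ levelPair f p q false) (h2 : x ∈ levelPair f p q true) : False := by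
  simp only [levelPair, Set.mem_ofPred_eq] at h1 h2
  linarith

theorem Set.Finite.isTame {K : Type*} [TopologicalSpace K] {F : Set C(K, ℝ)} (hF : F.Finite) :
    IsTame F := by
  intro f hf p q hpq hind
  obtain ⟨n, -, m, -, hnm, h⟩ := Set.infinite_univ.exists_ne_map_eq_of_mapsTo (fun n _ => hf n) hF
  obtain ⟨x, h1, h2⟩ := hind.exists_mem_inter hnm
  rw [h] at h1
  exact levelPair_disjoint _ hpq h1 h2

theorem IsTame.union {K : Type*} [TopologicalSpace K] {F G : Set C(K, ℝ)} (hF : IsTame F)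
    (hG : IsTame G) : IsTame (F ∪ G) := by
  intro f hf p q hpq hind
  have : (∃ᶠ n in atTop, f n ∈ F) ∨ ∃ᶠ n in atTop, f n ∈ G := by
    rw [← frequently_or_distrib]
    exact (Eventually.of_forall hf).frequently
  rcases this with h | h <;> obtain ⟨φ, hφ, hφf⟩ := extraction_of_frequently_atTop h
  · exact hF _ hφf p q hpq (hind.comp_strictMono hφ)
  · exact hG _ hφf p q hpq (hind.comp_strictMono hφ)

theorem IsTame.comp {K L : Type*} [TopologicalSpace K] [TopologicalSpace L] {F : Set C(L, ℝ)}
    (hF : IsTame F) (π : C(K, L)) : IsTame ((fun f => f.comp π) '' F) := by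
  intro f hf p q hpq hind
  choose g hg hgf using hf
  refine hF g hg p q hpq fun m ε => ?_
  obtain ⟨x, hx⟩ := hind m ε
  refine ⟨π x, fun n hn => ?_⟩
  have : x ∈ levelPair (f n) p q (ε n) := hx n hn
  rw [← hgf] at this
  change π x ∈ levelPair (g n) p q (ε n)
  cases h : ε n <;> rw [h] at this <;> exact this

/-! ### Splits -/

section Split

variable {L : Type u} {M : Type v} {ι : Type w} {r : ι → L} {f : ∀ ξ, {x : L // x ≠ r ξ} → M}

theorem mem_splitSpace_iff (hr : Function.Injective r) {p : L × (ι → M)} :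
    p ∈ splitSpace r f ↔ ∀ η, p.1 = r η ∨ ∃ h : p.1 ≠ r η, p.2 η = f η ⟨p.1, h⟩ := by
  obtain ⟨x, y⟩ := p
  constructor
  · rintro (⟨ξ, rfl, h⟩ | ⟨-, h⟩) η
    · by_cases hη : η = ξ
      · exact .inl (by rw [hη])
      · exact .inr (h η hη)
    · exact .inr (h η)
  · intro h
    by_cases hx : x ∈ Set.range r
    · obtain ⟨ξ, rfl⟩ := hx
      exact .inl ⟨ξ, rfl, fun η hη => (h η).resolve_left fun h' => hη (hr h').symm⟩
    · exact .inr ⟨hx, fun η => (h η).resolve_left fun h' => hx ⟨η, h'.symm⟩⟩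

theorem isClosed_splitSpace [TopologicalSpace L] [T1Space L] [TopologicalSpace M] [T2Space M]
    (hr : Function.Injective r) (hf : ∀ ξ, Continuous (f ξ)) : IsClosed (splitSpace r f) := by
  have heq : splitSpace r f =
      ⋂ η, {p | p.1 = r η ∨ ∃ h : p.1 ≠ r η, p.2 η = f η ⟨p.1, h⟩} := by
    ext p
    rw [mem_splitSpace_iff hr, Set.mem_iInter]
    rfl
  rw [heq]
  refine isClosed_iInter fun η => ⟨?_⟩
  have hopen : IsOpen {p : L × (ι → M) | p.1 ≠ r η} :=
    (isOpen_compl_singleton (x := r η)).preimage continuous_fst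
  have h1 : Continuous fun p : {p : L × (ι → M) // p.1 ≠ r η} => f η ⟨p.1.1, p.2⟩ :=
    (hf η).comp (Continuous.subtype_mk (continuous_fst.comp continuous_subtype_val) _)
  have h2 : Continuous fun p : {p : L × (ι → M) // p.1 ≠ r η} => p.1.2 η :=
    (continuous_apply η).comp (continuous_snd.comp continuous_subtype_val)
  have h3 := hopen.isOpenMap_subtype_val _ (isOpen_ne_fun h2 h1)
  convert h3 using 1
  ext p
  simp only [Set.mem_compl_iff, Set.mem_ofPred_eq, not_or, not_exists, Set.mem_image,
    Subtype.exists]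
  exact ⟨fun ⟨h, h'⟩ => ⟨p, h, h' h, rfl⟩, by rintro ⟨p, h, h', rfl⟩; exact ⟨h, fun _ => h'⟩⟩

/-- Independence of coordinates on the split descends to independence of partial functions on the
base. A point of the split realizing a sign pattern on the first `m` coordinates projects
to a point realizing it, unless it lies over one of the first `m` points `r`; the points of one
fibre differ in one coordinate only, so this exception cannot occur for all of the
`m + 1` patterns that continue the given one by a single `true`. -/
theorem mIndependentPartial_of_splitSpace [TopologicalSpace M] (hr : Function.Injective r)
    {ζ : ℕ → ι} {C C' : Set M} (hC : IsClosed C) (hC' : IsClosed C') (hCC' : Disjoint C C')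
    (hind : IndependentPairs fun n b =>
      {p : splitSpace r f | p.1.2 (ζ n) ∈ if b then C' else C}) :
    MIndependentPartial (fun n => r (ζ n)) fun n => f (ζ n) := by
  classical
  have hζ : Function.Injective ζ := by
    intro n m h
    by_contra hnm
    obtain ⟨x, h1, h2⟩ := hind.exists_mem_inter hnm
    simp only [Set.mem_ofPred_eq, Bool.false_eq_true, if_false, if_true, h] at h1 h2
    exact Set.disjoint_left.1 hCC' h1 h2
  obtain ⟨p₀, -⟩ := hind 0 fun _ => true
  refine ⟨fun n x => if h : x ≠ r (ζ n) then f (ζ n) ⟨x, h⟩ else p₀.1.2 (ζ n), fun n x => ?_, C, C',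
    hC, hC', hCC', fun m ε => ?_⟩
  · simp [x.2]
  have hp := fun k : Fin (m + 1) => hind (2 * m + 1) fun n =>
    if n < m then ε n else decide (n = m + k)
  choose p hp using hp
  by_cases hex : ∃ k, ∀ n < m, (p k).1.1 ≠ r (ζ n)
  · obtain ⟨k, hk⟩ := hex
    refine ⟨(p k).1.1, fun n hn => ?_⟩
    have h1 := hp k n (by lia)
    obtain ⟨h2, h3⟩ := ((mem_splitSpace_iff hr).1 (p k).2 (ζ n)).resolve_left (hk n hn)
    simp only [Set.mem_ofPred_eq, if_pos hn] at h1
    rw [h3] at h1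
    simpa only [Set.mem_preimage, dif_pos h2] using h1
  · exfalso
    push Not at hex
    choose i him hi using hex
    obtain ⟨k, k', hkk', hik⟩ := Fintype.exists_ne_map_eq_of_card_lt
      (fun k => (⟨i k, him k⟩ : Fin m)) (by simp)
    have hik' : i k = i k' := congrArg Fin.val hik
    have hx : (p k).1.1 = (p k').1.1 := by rw [hi, hi, hik']
    have hne : (p k).1.1 ≠ r (ζ (m + k)) := by
      rw [hi]
      intro h
      have := hζ (hr h)
      have := him k
      lia
    obtain ⟨_, h1⟩ := ((mem_splitSpace_iff hr).1 (p k).2 (ζ (m + k))).resolve_left hne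
    obtain ⟨_, h2⟩ := ((mem_splitSpace_iff hr).1 (p k').2 (ζ (m + k))).resolve_left (hx ▸ hne)
    have h3 : (p k).1.2 (ζ (m + k)) = (p k').1.2 (ζ (m + k)) := by
      rw [h1, h2]; simp only [hx]
    have h4 := hp k (m + k) (by lia)
    have h5 := hp k' (m + k) (by lia)
    have h6 : ¬ (m + (k : ℕ) = m + (k' : ℕ)) := fun h => hkk' (Fin.ext (by lia))
    have h7 : ¬ (m + (k : ℕ) < m) := by lia
    simp only [Set.mem_ofPred_eq, h7, h6, if_false, decide_true, decide_false, if_true,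
      Bool.false_eq_true] at h4 h5
    rw [h3] at h4
    exact Set.disjoint_left.1 hCC' h5 h4

/-- The split of a weakly Radon–Nikodým compact space is again one, if the splitting functions have
no independent sequences: distances to points of `M`, composed with the coordinates, together with
a tame separating family on the base form a tame separating family on the split. -/
theorem isWRN_splitSpace [TopologicalSpace L] [CompactSpace L] [T2Space L] [MetricSpace M]
    [CompactSpace M] (hr : Function.Injective r) (hf : ∀ ξ, Continuous (f ξ))
    (hind : ∀ ξ : ℕ → ι, ¬ MIndependentPartial (fun n => r (ξ n)) fun n => f (ξ n))
    (hL : IsWRN L) : IsWRN (splitSpace r f) := by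
  have : CompactSpace (splitSpace r f) :=
    isCompact_iff_compactSpace.1 (isClosed_splitSpace hr hf).isCompact
  obtain ⟨F, hF, hF1, hFsep⟩ := hL.exists_isTame
  let π : C(splitSpace r f, L) := ⟨fun p => p.1.1, by fun_prop⟩
  obtain ⟨D, hD⟩ : ∃ D : ℝ, ∀ x y : M, dist x y ≤ D := by
    obtain ⟨D, hD⟩ := Metric.isBounded_iff.1 (isCompact_univ (X := M)).isBounded
    exact ⟨D, fun x y => hD (Set.mem_univ x) (Set.mem_univ y)⟩
  let c : ℝ := (|D| + 1)⁻¹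
  have hc : 0 < c := by positivity
  have hcD : ∀ x y : M, c * dist x y ≤ 1 := fun x y => by
    rw [inv_mul_le_iff₀ (by positivity), mul_one]
    linarith [hD x y, le_abs_self D]
  let G : Set C(splitSpace r f, ℝ) := {g | ∃ d ξ, ∀ p, g p = c * dist d (p.1.2 ξ)}
  have hG : IsTame G := by
    intro g hg p q hpq hindep
    choose d ξ hg using hg
    -- The centres converge along a subsequence, so they may be replaced by their limit.
    obtain ⟨d₀, φ, hφ, hd⟩ := CompactSpace.tendsto_subseq d
    have hη : 0 < (q - p) / (4 * c) := by have := sub_pos.2 hpq; positivity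
    obtain ⟨N, hN⟩ := (Metric.tendsto_atTop.1 hd) _ hη
    have hψ : StrictMono fun n => φ (n + N) := hφ.comp (strictMono_id.add_const N)
    have hclose : ∀ n (y : M), |c * dist (d (φ (n + N))) y - c * dist d₀ y| < (q - p) / 4 := by
      intro n y
      rw [← mul_sub, abs_mul, abs_of_pos hc]
      have h1 := (abs_dist_sub_le (d (φ (n + N))) d₀ y).trans_lt (hN (n + N) (by lia))
      calc c * |dist (d (φ (n + N))) y - dist d₀ y| < c * ((q - p) / (4 * c)) := by gcongr
        _ = (q - p) / 4 := by field_simp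
    refine hind (fun n => ξ (φ (n + N))) (mIndependentPartial_of_splitSpace hr
      (C := {y | c * dist d₀ y ≤ p + (q - p) / 4}) (C' := {y | q - (q - p) / 4 ≤ c * dist d₀ y})
      (isClosed_le (by fun_prop) (by fun_prop)) (isClosed_le (by fun_prop) (by fun_prop))
      (Set.disjoint_left.2 fun y h1 h2 => ?_) ((hindep.comp_strictMono hψ).mono ?_))
    · simp only [Set.mem_ofPred_eq] at h1 h2
      linarith
    · intro n b x hx
      have h1 := abs_lt.1 (hclose n (x.1.2 (ξ (φ (n + N)))))
      cases b
      · simp only [levelPair, hg, Set.mem_ofPred_eq, Bool.false_eq_true, if_false] at hx ⊢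
        linarith
      · simp only [levelPair, hg, Set.mem_ofPred_eq, if_true] at hx ⊢
        linarith
  refine ((hF.comp π).union hG).isWRN ?_ ?_
  · rintro g (⟨g, hg, rfl⟩ | ⟨d, ξ, hg⟩)
    · exact (ContinuousMap.norm_le _ zero_le_one).2 fun p => hF1 g hg _
    · refine (ContinuousMap.norm_le _ zero_le_one).2 fun p => ?_
      rw [hg, Real.norm_of_nonneg (by positivity)]
      exact hcD _ _
  · intro x y hxy
    by_cases h : x.1.1 = y.1.1
    · obtain ⟨ξ, hξ⟩ : ∃ ξ, x.1.2 ξ ≠ y.1.2 ξ := by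
        by_contra! h'
        exact hxy (Subtype.ext (Prod.ext h (funext h')))
      refine ⟨⟨fun p => c * dist (x.1.2 ξ) (p.1.2 ξ), by fun_prop⟩,
        .inr ⟨x.1.2 ξ, ξ, fun _ => rfl⟩, ?_⟩
      simpa [hc.ne'] using hξ
    · obtain ⟨g, hg, hgxy⟩ := hFsep _ _ h
      exact ⟨g.comp π, .inl ⟨g, hg, rfl⟩, hgxy⟩

end Split

/-! ### Filippov spaces -/

instance : CompactSpace UnitSquare := by
  have h := (isCompact_univ_pi fun _ : Fin 2 => isCompact_Icc (a := (0 : ℝ)) (b := 1)).image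
    (PiLp.continuous_toLp 2 fun _ : Fin 2 => ℝ)
  suffices hK : IsCompact {x : EuclideanSpace ℝ (Fin 2) | ∀ i, x i ∈ Set.Icc (0 : ℝ) 1} from
    isCompact_iff_compactSpace.1 hK
  convert h using 1
  ext x
  exact ⟨fun hx => ⟨x.ofLp, fun i _ => hx i, rfl⟩, by rintro ⟨y, hy, rfl⟩ i; exact hy i trivial⟩

theorem isWRN_unitSquare : IsWRN UnitSquare := by
  let F : Set C(UnitSquare, ℝ) := Set.range fun i : Fin 2 => ⟨fun x => x.1 i, by fun_prop⟩
  refine (Set.finite_range _ : F.Finite).isTame.isWRN ?_ fun x y hxy => ?_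
  · rintro _ ⟨i, rfl⟩
    refine (ContinuousMap.norm_le _ zero_le_one).2 fun x => ?_
    have := x.2 i
    exact (abs_of_nonneg this.1).trans_le this.2
  · by_contra! h
    exact hxy (Subtype.ext (PiLp.ext fun i => h _ ⟨i, rfl⟩))

theorem tendsto_directionFrom {α : Type*} {l : Filter α} {a y : α → UnitSquare} {a₀ y₀ : UnitSquare}
    (ha : Tendsto a l (𝓝 a₀)) (hy : Tendsto y l (𝓝 y₀)) (hne : y₀ ≠ a₀)
    {G : α → Metric.sphere (0 : EuclideanSpace ℝ (Fin 2)) 1}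
    (hG : ∀ n, ∀ h : y n ≠ a n, G n = directionFrom (a n) ⟨y n, h⟩) :
    Tendsto G l (𝓝 (directionFrom a₀ ⟨y₀, hne⟩)) := by
  rw [tendsto_subtype_rng]
  have hsub : Tendsto (fun n => (y n).1 - (a n).1) l (𝓝 (y₀.1 - a₀.1)) :=
    ((continuous_subtype_val.tendsto _).comp hy).sub ((continuous_subtype_val.tendsto _).comp ha)
  have h0 : ‖y₀.1 - a₀.1‖ ≠ 0 := norm_ne_zero_iff.2 (sub_ne_zero.2 fun h => hne (Subtype.ext h))
  refine ((hsub.norm.inv₀ h0).smul hsub).congr' ?_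
  filter_upwards [(hy.prodMk_nhds ha).eventually
    ((isOpen_ne_fun continuous_fst continuous_snd).mem_nhds hne)] with n hn
  rw [hG n hn]
  rfl

theorem continuous_directionFrom (r : UnitSquare) : Continuous (directionFrom r) := by
  refine continuous_iff_continuousAt.2 fun x => ?_
  exact tendsto_directionFrom tendsto_const_nhds (continuous_subtype_val.tendsto x) x.2
    fun _ _ => rfl

/-- Sequences of direction functions are not independent: along a subsequence for which the centres
converge, as well as the values at their limit, the functions converge pointwise. -/
theorem not_mIndependentPartial_directionFrom (r : ℕ → UnitSquare) :
    ¬ MIndependentPartial r fun n => directionFrom (r n) := by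
  rintro ⟨g, hg, C, C', hC, hC', hCC', hind⟩
  have hr : Function.Injective r := by
    intro n m hnm
    by_contra hne
    -- Off the common centre the `n`-th and `m`-th functions agree, so every pattern that
    -- distinguishes them is realized at the centre only, whatever it prescribes elsewhere.
    have key : ∀ b : Bool, g (n + m + 1) (r m) ∈ if b then C' else C := by
      intro b
      obtain ⟨x, hx⟩ := hind (n + m + 2) fun k => if k = n then false else if k = m then true else b
      have h1 := hx n (by lia)
      have h2 := hx m (by lia)
      have h3 := hx (n + m + 1) (by lia)
      simp only [Set.mem_preimage, if_true, Ne.symm hne, if_false, Bool.false_eq_true] at h1 h2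
      rw [if_neg (by lia), if_neg (by lia)] at h3
      by_cases hxr : x = r m
      · rw [← hxr]; exact h3
      · have e1 := hg n ⟨x, hnm ▸ hxr⟩
        have e2 := hg m ⟨x, hxr⟩
        have e3 : g n x = g m x := by
          rw [e1, e2]; simp only [directionFrom, hnm]
        rw [e3] at h1
        exact (Set.disjoint_left.1 hCC' h1 h2).elim
    exact Set.disjoint_left.1 hCC' (by simpa using key false) (by simpa using key true)
  obtain ⟨ρ, φ, hφ, hρ⟩ := CompactSpace.tendsto_subseq r
  obtain ⟨s, ψ, hψ, hs⟩ := CompactSpace.tendsto_subseq fun n => g (φ n) ρ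
  set θ : ℕ → ℕ := fun n => φ (ψ n)
  have hθm : StrictMono θ := hφ.comp hψ
  replace hρ : Tendsto (fun n => r (θ n)) atTop (𝓝 ρ) := hρ.comp hψ.tendsto_atTop
  replace hs : Tendsto (fun n => g (θ n) ρ) atTop (𝓝 s) := hs
  have hindθ := hind.comp_strictMono hθm
  have hconv : ∀ x, ∃ t, Tendsto (fun n => g (θ n) x) atTop (𝓝 t) := by
    intro x
    by_cases hx : x = ρ
    · exact ⟨s, hx ▸ hs⟩
    · exact ⟨_, tendsto_directionFrom hρ tendsto_const_nhds hx fun n h => hg (θ n) ⟨x, h⟩⟩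
  -- Finite initial segments of the alternating pattern are realized; take a limit point.
  choose z hz using fun m => hindθ m fun n => decide (Even n)
  obtain ⟨x, χ, hχ, hx⟩ := CompactSpace.tendsto_subseq z
  have hclosed : ∀ b : Bool, IsClosed (if b then C' else C) := by
    intro b; cases b <;> simpa
  have hmem : ∀ n, x ≠ r (θ n) → g (θ n) x ∈ if decide (Even n) then C' else C := by
    intro n hn
    have h1 : Tendsto (fun m => g (θ n) (z (χ m))) atTop (𝓝 (g (θ n) x)) := by
      rw [hg (θ n) ⟨x, hn⟩]
      exact tendsto_directionFrom tendsto_const_nhds hx hn fun m h => hg (θ n) ⟨_, h⟩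
    refine (hclosed _).mem_of_tendsto h1 ?_
    filter_upwards [hχ.tendsto_atTop.eventually_gt_atTop n] with m hm
    exact hz (χ m) n hm
  have hev : ∀ᶠ n in atTop, x ≠ r (θ n) := by
    have hsub : {n | x = r (θ n)}.Subsingleton := fun n hn m hm =>
      hθm.injective (hr (hn.symm.trans hm))
    rw [← Nat.cofinite_eq_atTop]
    exact hsub.finite.compl_mem_cofinite
  obtain ⟨t, ht⟩ := hconv x
  have heven : Tendsto (fun n : ℕ => 2 * n) atTop atTop :=
    tendsto_atTop_mono (fun n => by rw [id]; lia) tendsto_id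
  have hodd : Tendsto (fun n : ℕ => 2 * n + 1) atTop atTop :=
    tendsto_atTop_mono (fun n => by rw [id]; lia) tendsto_id
  have htC' : t ∈ C' := hC'.mem_of_tendsto (ht.comp heven) (by
    filter_upwards [heven.eventually hev] with n hn
    simpa using hmem _ hn)
  have htC : t ∈ C := hC.mem_of_tendsto (ht.comp hodd) (by
    filter_upwards [hodd.eventually hev] with n hn
    simpa using hmem _ hn)
  exact Set.disjoint_left.1 hCC' htC htC'

theorem theorem7p5 :
    (∀ (L : Type u) [TopologicalSpace L] [CompactSpace L] [T2Space L]
        (M : Type v) [MetricSpace M] [CompactSpace M]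
        (ι : Type w) (r : ι → L) (f : ∀ ξ, {x : L // x ≠ r ξ} → M),
        Function.Injective r →
        (∀ ξ, Continuous (f ξ)) →
        (∀ ξ : ℕ → ι, ¬ MIndependentPartial (fun n => r (ξ n)) (fun n => f (ξ n))) →
        IsWRN L →
        IsWRN (splitSpace r f)) ∧
    (∀ (ι : Type w) (r : ι → UnitSquare), Function.Injective r →
        IsWRN (FilippovSpace r)) := by
  refine ⟨?_, fun ι r hr => ?_⟩
  · intro L _ _ _ M _ _ ι r f hr hf hind hL
    exact isWRN_splitSpace hr hf hind hL
  · exact isWRN_splitSpace hr (fun ξ => continuous_directionFrom (r ξ))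
      (fun ξ => not_mIndependentPartial_directionFrom fun n => r (ξ n)) isWRN_unitSquare
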